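/- **Setting.** A (conjunctive) query $Q$ is a formula $\exists X_1,\dots,X_n\;\Phi$, where $\Phi$ is a conjunction of $m\ge 1$ atoms whose arguments are variables or constants; $\mathit{atoms}(Q)$ is its set of atoms, $\mathit{vars}(Q)$ the set of variables occurring in them, and $\mathit{free}(Q)=\mathit{vars}(Q)\setminus\{X_1,\dots,X_n\}$. A database $\mathrm D$ is a finite relational structure whose universe consists of constants. $Q^{\mathrm D}$ is the set of all substitutions of constants of $\mathrm D$ for the variables of $Q$ that map every atom of $Q$ into $\mathrm D$; an atom $a$ alone similarly determines the set $a^{\mathrm D}$ of substitutions for $\mathit{vars}(a)$ that map $a$ into $\mathrm D$. $\pi_W(S)$ is the set of restrictions to $W$ of the substitutions in $S$, and $\mathrm{count}(Q,\mathrm D)=|\pi_{\mathit{free}(Q)}(Q^{\mathrm D})|$. A *view set* for $Q$ is a set $\mathcal V$ of atoms (views) over the variables of $Q$, each one over its own relation symbol not occurring in $Q$, containing for every $q\in\mathit{atoms}(Q)$ a query view $w_q$ with the same list of variables as $q$. A database $\mathrm D$ whose vocabulary includes the symbols of $Q$ and $\mathcal V$ is *legal* if $w_q^{\mathrm D}\subseteq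 q^{\mathrm D}$ for every $q\in\mathit{atoms}(Q)$ and $w^{\mathrm D}\supseteq\pi_{\mathit{vars}(w)}(Q^{\mathrm D})$ for every $w\in\mathcal V$. The hypergraph $\mathcal H_A$ of a set $A$ of atoms has the variables of $A$ as nodes and the sets $\mathit{vars}(a)$, $a\in A$, as hyperedges. Write $\mathcal H_1\le\mathcal H_2$ if every hyperedge of $\mathcal H_1$ is contained in a hyperedge of $\mathcal H_2$. A hypergraph is acyclic if it has a join tree, i.e. a tree on its hyperedges such that every node occurring in two hyperedges occurs in all hyperedges on the path between them. $\mathit{color}(Q)$ is $Q$ with an additional atom $r_X(X)$, $r_X$ a fresh symbol, for each $X\in\mathit{free}(Q)$. A core of $\mathit{color}(Q)$ is a minimal subset of its atoms (as a substructure) to which there is a homomorphism from $\mathit{color}(Q)$, where homomorphisms fix constants. For a set $A$ of atoms and a set $W$ of variables, a $[W]$-component of $\mathcal H_A$ is a connected component of the variables of $A$ outside $W$, two of them being adjacent if some hyperedge contains both; the frontier of $Y\notin W$ is the set of variables in $W$ lying on a hyperedge that meets the $[W]$-component of $Y$, and the frontier of $Y\in W$ is empty. The hyperedges of the frontier hypergraph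 $\mathcal{FH}(A,W)$ are the frontiers of all variables of $A$ and the hyperedges of $\mathcal H_A$ contained in $W$. A *$\#$-decomposition* of $Q$ with respect to $\mathcal V$ is an acyclic hypergraph $\mathcal H_a$ such that, for some core $Q'$ of $\mathit{color}(Q)$, $\mathcal H_{Q'}\le\mathcal H_a\le\mathcal H_{\mathcal V}$ and $\mathcal{FH}(Q',\mathit{free}(Q))\le\mathcal H_a$. $\|Q\|$, $\|\mathrm D\|$, $\|\mathcal H_a\|$ denote the sizes of standard encodings (names of variables, constants and relation symbols having unit size, arities written in unary). **Theorem.** There are an algorithm and a polynomial $P$ such that, given any query $Q$, view set $\mathcal V$ for $Q$, legal database $\mathrm D$, and $\#$-decomposition $\mathcal H_a$ of $Q$ with respect to $\mathcal V$ (no core of $\mathit{color}(Q)$ being part of the input), the algorithm outputs $\mathrm{count}(Q,\mathrm D)$ in binary within time $P(\|Q\|+\|\mathrm D\|+\|\mathcal H_a\|)$. -/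

import Mathlib

namespace CountCQ

/-! ### Hypergraphs -/

/-- `H₁ ≤ H₂`: every hyperedge of `H₁` is contained in some hyperedge of `H₂`. -/
def Covers (H₁ H₂ : Hypergraph ℕ) : Prop :=
  ∀ e ∈ H₁.edgeSet, ∃ f ∈ H₂.edgeSet, e ⊆ f

/-- `T` is a join tree of `H`: a tree on the hyperedges of `H` such that a node that occurs in
two hyperedges occurs in every hyperedge on the path of `T` that links them. -/
def IsJoinTree (H : Hypergraph ℕ) (T : SimpleGraph H.edgeSet) : Prop :=
  T.IsTree ∧ ∀ (h₁ h₂ : H.edgeSet) (x : ℕ), x ∈ h₁.1 → x ∈ h₂.1 →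
    ∀ p : T.Walk h₁ h₂, p.IsPath → ∀ h ∈ p.support, x ∈ h.1

/-- (Alpha-)acyclicity: there is a join tree. -/
def IsAcyclic (H : Hypergraph ℕ) : Prop := ∃ T : SimpleGraph H.edgeSet, IsJoinTree H T

/-- `Ha` is a tree projection of `H₁` with respect to `H₂`. -/
def IsTreeProjection (Ha H₁ H₂ : Hypergraph ℕ) : Prop :=
  IsAcyclic Ha ∧ Covers H₁ Ha ∧ Covers Ha H₂

/-- `x` is `W`-adjacent to `y` in `H`. -/
def WAdj (H : Hypergraph ℕ) (W : Set ℕ) (x y : ℕ) : Prop :=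
  ∃ h ∈ H.edgeSet, x ∈ h \ W ∧ y ∈ h \ W

/-- The `W`-component of `H` in which `y` occurs (for a node `y` of `H` outside `W`): the nodes
outside `W` that are linked to `y` by a sequence of `W`-adjacent nodes. -/
def component (H : Hypergraph ℕ) (W : Set ℕ) (y : ℕ) : Set ℕ :=
  {x | x ∈ H.vertexSet \ W ∧ Relation.ReflTransGen (WAdj H W) y x}

/-- The frontier of `y` with respect to `W` in `H`: empty if `y ∈ W`; otherwise the nodes of `W`
that lie on a hyperedge meeting the `W`-component of `y`. -/
def frontierOf (y : ℕ) (W : Set ℕ) (H : Hypergraph ℕ) : Set ℕ :=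
  {x | y ∉ W ∧ x ∈ W ∧ ∃ h ∈ H.edgeSet, (h ∩ component H W y).Nonempty ∧ x ∈ h}

/-! ### Terms, atoms, queries -/

/-- Terms are variables or constants; the two (disjoint) universes are indexed by `ℕ`. -/
inductive Term where
  | var (x : ℕ)
  | const (c : ℕ)

/-- An atom `rel(args)` over relation symbols from `S`. -/
structure Atom (S : Type) where
  rel : S
  args : List Term

/-- The variables of an atom. -/
def Atom.vars {S : Type} (a : Atom S) : Set ℕ := {x | Term.var x ∈ a.args}

/-- The list of variables of an atom (constants are skipped). -/
def Atom.varList {S : Type} (a : Atom S) : List ℕ :=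
  a.args.filterMap fun t => match t with
    | Term.var x => some x
    | Term.const _ => none

/-- The variables occurring in a set of atoms. -/
def varsOf {S : Type} (A : Set (Atom S)) : Set ℕ := {x | ∃ a ∈ A, x ∈ a.vars}

/-- The hypergraph associated with a set of atoms. -/
def hypergraphOf {S : Type} (A : Set (Atom S)) : Hypergraph ℕ where
  vertexSet := varsOf A
  edgeSet := Atom.vars '' A
  subset_vertexSet_of_mem_edgeSet' := by
    rintro _ ⟨a, ha, rfl⟩ x hx
    exact ⟨a, ha, hx⟩

/-- The frontier hypergraph of a set of atoms `A` with respect to `W`: its hyperedges are the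
frontiers of the variables of `A` and the hyperedges of the hypergraph of `A` contained in `W`. -/
def frontierHypergraph {S : Type} (A : Set (Atom S)) (W : Set ℕ) : Hypergraph ℕ where
  vertexSet := varsOf A ∪ W
  edgeSet := {e | ∃ y ∈ varsOf A, e = frontierOf y W (hypergraphOf A)} ∪
    {e | e ∈ (hypergraphOf A).edgeSet ∧ e ⊆ W}
  subset_vertexSet_of_mem_edgeSet' := by
    rintro e (⟨y, _, rfl⟩ | ⟨_, he⟩) x hx
    · exact Or.inr hx.2.1
    · exact Or.inr (he hx)

/-- A homomorphism between two sets of atoms, viewed as relational structures on their terms: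
it fixes the constants and maps atoms to atoms. -/
def HasHom {S : Type} (A B : Set (Atom S)) : Prop :=
  ∃ h : Term → Term, (∀ c, h (Term.const c) = Term.const c) ∧
    ∀ a ∈ A, (⟨a.rel, a.args.map h⟩ : Atom S) ∈ B

/-- `B` is a core of `A`: a minimal substructure of `A` to which `A` has a homomorphism. -/
def IsCore {S : Type} (B A : Set (Atom S)) : Prop :=
  Minimal (fun C => C ⊆ A ∧ HasHom A C) B

/-- A conjunctive query `∃ quantified, ⋀ atoms`, with at least one atom. -/
structure Query where
  atoms : List (Atom ℕ)
  quantified : List ℕ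
  atoms_ne_nil : atoms ≠ []

/-- `atoms(Q)` as a set. -/
def Query.atomSet (Q : Query) : Set (Atom ℕ) := {a | a ∈ Q.atoms}

/-- `vars(Q)`. -/
def Query.vars (Q : Query) : Set ℕ := varsOf Q.atomSet

/-- `free(Q)`. -/
def Query.free (Q : Query) : Set ℕ := Q.vars \ {x | x ∈ Q.quantified}

/-- The atoms of `color(Q)`: those of `Q` (symbol `r` becoming `Sum.inl r`) and, for every free
variable `X`, an atom `r_X(X)` over the fresh symbol `r_X = Sum.inr X`. -/
def Query.color (Q : Query) : Set (Atom (ℕ ⊕ ℕ)) :=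
  {b | (∃ a ∈ Q.atoms, b = ⟨Sum.inl a.rel, a.args⟩) ∨
    ∃ x ∈ Q.free, b = ⟨Sum.inr x, [Term.var x]⟩}

/-! ### Databases and answers -/

/-- A relation instance: a symbol, its arity, and a finite set of tuples (given as a list). -/
structure RelInstance where
  sym : ℕ
  arity : ℕ
  tuples : List (List ℕ)

/-- A database: a finite relational structure over the finite set `dom` of constants. Each symbol
of its vocabulary is listed once, with its relation instance. -/
structure Database where
  dom : List ℕ
  rels : List RelInstance
  nodup_sym : (rels.map RelInstance.sym).Nodup
  length_tuple : ∀ R ∈ rels, ∀ u ∈ R.tuples, u.length = R.arity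
  mem_dom : ∀ R ∈ rels, ∀ u ∈ R.tuples, ∀ c ∈ u, c ∈ dom

/-- The vocabulary of `D` contains the symbol of the atom `a`, with the right arity. -/
def Database.Declares (D : Database) (a : Atom ℕ) : Prop :=
  ∃ R ∈ D.rels, R.sym = a.rel ∧ R.arity = a.args.length

/-- The ground atom `r(u)` belongs to `D`. -/
def Database.Holds (D : Database) (r : ℕ) (u : List ℕ) : Prop :=
  ∃ R ∈ D.rels, R.sym = r ∧ u ∈ R.tuples

/-- The value of a term under a substitution. -/
def Term.eval (θ : ℕ → ℕ) : Term → ℕ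
  | Term.var x => θ x
  | Term.const c => c

/-- The substitutions that map the atom `a` into `D`. Substitutions are written as total
functions on variables; only their restrictions (see `proj`) to variables that occur in the atoms
are ever used, and on these variables their values belong to `D.dom`. -/
def Atom.sols (a : Atom ℕ) (D : Database) : Set (ℕ → ℕ) :=
  {θ | D.Holds a.rel (a.args.map (Term.eval θ))}

/-- `Q^D`: the substitutions that map all atoms of `Q` into `D`. -/
def Query.sols (Q : Query) (D : Database) : Set (ℕ → ℕ) := {θ | ∀ a ∈ Q.atoms, θ ∈ a.sols D}

/-- `π_W(S)`: the restrictions to `W` of the substitutions in `S`. -/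
def proj (W : Set ℕ) (S : Set (ℕ → ℕ)) : Set (W → ℕ) := (fun θ (x : W) => θ x) '' S

/-- The answers of `Q` on `D`, that is, `π_{free(Q)}(Q^D)`. -/
def Query.answers (Q : Query) (D : Database) : Set (Q.free → ℕ) := proj Q.free (Q.sols D)

/-- A query has finitely many answers, so that `Set.ncard` below is their number. -/
theorem Query.finite_answers (Q : Query) (D : Database) : (Q.answers D).Finite := by
  have hvars : Q.vars.Finite := by
    have : Q.vars = ⋃ a ∈ {a | a ∈ Q.atoms}, a.vars := by
      ext x; simp [Query.vars, varsOf, Query.atomSet]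
    rw [this]
    refine (List.finite_toSet Q.atoms).biUnion fun a _ => ?_
    exact (List.finite_toSet a.args).preimage fun _ _ _ _ h => by simpa using h
  have hfree : Finite Q.free := (hvars.subset Set.sdiff_subset).to_subtype
  refine (Set.Finite.pi' (fun _ : Q.free => List.finite_toSet D.dom)).subset ?_
  rintro _ ⟨θ, hθ, rfl⟩ ⟨x, ⟨a, ha, hx⟩, _⟩
  obtain ⟨R, hR, _, hu⟩ := hθ a ha
  exact D.mem_dom R hR _ hu _ (List.mem_map.2 ⟨Term.var x, hx, rfl⟩)

/-- `count(Q, D)`: the number of answers. -/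
noncomputable def count (Q : Query) (D : Database) : ℕ := (Q.answers D).ncard

/-! ### Views, legal databases, `#`-decompositions -/

/-- `V` is a view set for `Q`, where `wq q` is the query view associated with the atom `q`.
Views are atoms over the variables of `Q`, each one over its own relation symbol, which does not
occur in `Q`; the query view of `q` has the same list of variables as `q`. -/
structure IsViewSet (Q : Query) (V : List (Atom ℕ)) (wq : Atom ℕ → Atom ℕ) : Prop where
  nodup_rel : (V.map Atom.rel).Nodup
  rel_ne : ∀ w ∈ V, ∀ q ∈ Q.atoms, w.rel ≠ q.rel
  vars_subset : ∀ w ∈ V, w.vars ⊆ Q.vars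
  queryView_mem : ∀ q ∈ Q.atoms, wq q ∈ V
  queryView_varList : ∀ q ∈ Q.atoms, (wq q).varList = q.varList

/-- `D` is a legal database on `V` with respect to `Q`. -/
structure IsLegal (Q : Query) (V : List (Atom ℕ)) (wq : Atom ℕ → Atom ℕ) (D : Database) :
    Prop where
  declares_query : ∀ q ∈ Q.atoms, D.Declares q
  declares_view : ∀ w ∈ V, D.Declares w
  queryView_subset : ∀ q ∈ Q.atoms, proj q.vars ((wq q).sols D) ⊆ proj q.vars (q.sols D)
  view_superset : ∀ w ∈ V, proj w.vars (Q.sols D) ⊆ proj w.vars (w.sols D)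

/-- A `#`-decomposition of `Q` with respect to `V`: a tree projection, for some core `A` of
`color(Q)`, of the hypergraph of `A` with respect to the hypergraph of `V`, that also covers the
frontier hypergraph of `A` with respect to `free(Q)`. -/
def IsSharpDecomposition (Q : Query) (V : List (Atom ℕ)) (Ha : Hypergraph ℕ) : Prop :=
  ∃ A : Set (Atom (ℕ ⊕ ℕ)), IsCore A Q.color ∧
    IsTreeProjection Ha (hypergraphOf A) (hypergraphOf {w | w ∈ V}) ∧
    Covers (frontierHypergraph A Q.free) Ha

/-- A finite hypergraph written down as a list of nodes and a list of hyperedges. -/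
structure HypergraphList where
  nodes : List ℕ
  edges : List (List ℕ)
  mem_nodes : ∀ e ∈ edges, ∀ x ∈ e, x ∈ nodes

/-- The hypergraph that is written down. -/
def HypergraphList.toHypergraph (L : HypergraphList) : Hypergraph ℕ where
  vertexSet := {x | x ∈ L.nodes}
  edgeSet := {e | ∃ l ∈ L.edges, e = {x | x ∈ l}}
  subset_vertexSet_of_mem_edgeSet' := by
    rintro _ ⟨l, hl, rfl⟩ x hx
    exact L.mem_nodes l hl x hx

/-! ### The model of computation

Algorithms are programs of a small deterministic language on finite binary trees, whose leaves are
blank or carry a name; a program can copy names and test two names for equality, and nothing else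
(in particular there is no built-in arithmetic). Every elementary operation, applied to a tree, is
charged the number of nodes of the whole tree, and every control construct is charged one more
unit. Hence the cost of a computation bounds the size of every tree that occurs in it, and (a name
counting as one symbol) it is polynomially related to the running time on a Turing machine. -/

/-- Binary trees with blank or named leaves. -/
inductive Data where
  | nil
  | name (n : ℕ)
  | pair (a b : Data)

/-- The number of nodes of a tree. -/
def Data.size : Data → ℕ
  | Data.nil => 1
  | Data.name _ => 1
  | Data.pair a b => a.size + b.size + 1

/-- The left subtree (`nil` for a leaf). -/
def Data.left : Data → Data
  | Data.pair a _ => a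
  | _ => Data.nil

/-- The right subtree (`nil` for a leaf). -/
def Data.right : Data → Data
  | Data.pair _ b => b
  | _ => Data.nil

/-- Truth values: `nil` is false, and `pair nil nil` is the standard "true". -/
def Data.ofBool : Bool → Data
  | false => Data.nil
  | true => Data.pair Data.nil Data.nil

/-- Are the two subtrees leaves that carry the same name? -/
def Data.sameName : Data → Data
  | Data.pair (Data.name m) (Data.name n) => Data.ofBool (decide (m = n))
  | _ => Data.nil

/-- Programs; each one maps an input tree to an output tree. -/
inductive Prog where
  /-- return the input -/
  | id
  /-- return `nil` -/
  | nil
  /-- return the left subtree -/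
  | left
  /-- return the right subtree -/
  | right
  /-- compare two names -/
  | sameName
  /-- run both programs on the input and pair their outputs -/
  | pair (p q : Prog)
  /-- run `p` on the input, then `q` on its output -/
  | seq (p q : Prog)
  /-- run `c` on the input; then run `p` on the input if the output of `c` is not `nil`, and `q`
  otherwise -/
  | ite (c p q : Prog)
  /-- as long as the output of `c` on the current tree is not `nil`, replace the current tree by
  the output of `p` on it -/
  | loop (c p : Prog)

/-- `p.Runs x y t`: on input `x` the program `p` halts with output `y`, at cost `t`. -/
inductive Prog.Runs : Prog → Data → Data → ℕ → Prop
  | id (x : Data) : Runs Prog.id x x x.size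
  | nil (x : Data) : Runs Prog.nil x Data.nil x.size
  | left (x : Data) : Runs Prog.left x x.left x.size
  | right (x : Data) : Runs Prog.right x x.right x.size
  | sameName (x : Data) : Runs Prog.sameName x x.sameName x.size
  | pair {p q : Prog} {x y z : Data} {s t : ℕ} :
      Runs p x y s → Runs q x z t → Runs (Prog.pair p q) x (Data.pair y z) (s + t + 1)
  | seq {p q : Prog} {x y z : Data} {s t : ℕ} :
      Runs p x y s → Runs q y z t → Runs (Prog.seq p q) x z (s + t + 1)
  | ite_true {c p q : Prog} {x b y : Data} {s t : ℕ} :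
      Runs c x b s → b ≠ Data.nil → Runs p x y t → Runs (Prog.ite c p q) x y (s + t + 1)
  | ite_false {c p q : Prog} {x y : Data} {s t : ℕ} :
      Runs c x Data.nil s → Runs q x y t → Runs (Prog.ite c p q) x y (s + t + 1)
  | loop_stop {c p : Prog} {x : Data} {s : ℕ} :
      Runs c x Data.nil s → Runs (Prog.loop c p) x x (s + 1)
  | loop_step {c p : Prog} {x b y z : Data} {s t u : ℕ} :
      Runs c x b s → b ≠ Data.nil → Runs p x y t → Runs (Prog.loop c p) y z u →
        Runs (Prog.loop c p) x z (s + t + u + 1)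

/-! ### Encodings and sizes -/

/-- A list, as a right-nested tree. -/
def encodeList {α : Type} (f : α → Data) : List α → Data
  | [] => Data.nil
  | a :: l => Data.pair (f a) (encodeList f l)

/-- A term: its kind and its name. -/
def Term.encode : Term → Data
  | Term.var x => Data.pair (Data.ofBool false) (Data.name x)
  | Term.const c => Data.pair (Data.ofBool true) (Data.name c)

/-- An atom: its relation symbol and its list of terms. -/
def Atom.encode (a : Atom ℕ) : Data :=
  Data.pair (Data.name a.rel) (encodeList Term.encode a.args)

/-- A query: its atoms and its quantified variables. -/
def Query.encode (Q : Query) : Data :=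
  Data.pair (encodeList Atom.encode Q.atoms) (encodeList Data.name Q.quantified)

/-- A relation instance: its symbol, its arity (in unary) and its tuples. -/
def RelInstance.encode (R : RelInstance) : Data :=
  Data.pair (Data.name R.sym) (Data.pair (encodeList id (List.replicate R.arity Data.nil))
    (encodeList (encodeList Data.name) R.tuples))

/-- A database: its domain and its relation instances. -/
def Database.encode (D : Database) : Data :=
  Data.pair (encodeList Data.name D.dom) (encodeList RelInstance.encode D.rels)

/-- A hypergraph: its nodes and its hyperedges. -/
def HypergraphList.encode (L : HypergraphList) : Data :=
  Data.pair (encodeList Data.name L.nodes) (encodeList (encodeList Data.name) L.edges)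

/-- A natural number, as the list of its binary digits (least significant digit first). -/
def encodeNat (n : ℕ) : Data := encodeList Data.ofBool n.bits

/-- The input of the counting problem: query, views, database, `#`-decomposition. -/
def encodeInput (Q : Query) (V : List (Atom ℕ)) (D : Database) (L : HypergraphList) : Data :=
  Data.pair Q.encode (Data.pair (encodeList Atom.encode V) (Data.pair D.encode L.encode))

/-- `||Q||`: the size of the encoding of `Q`. -/
def Query.size (Q : Query) : ℕ := Q.encode.size

/-- `||D||`: the size of the encoding of `D`. -/
def Database.size (D : Database) : ℕ := D.encode.size

/-- `||H_a||`: the size of the encoding of the hypergraph. -/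
def HypergraphList.size (L : HypergraphList) : ℕ := L.encode.size

end CountCQ

open CountCQ

/-!
The number of answers is computed without knowing a core of the coloured query.

Let `h` range over the hyperedges of the decomposition `Ha`. The relation `R h` (`baseEntry`)
consists of the restrictions to `h` of the rows of the views that cover `h`, filtered by all atoms
of the query whose variables lie in `h`. As the database is legal, every answer solves the join of
these relations (`solves_baseJoin`). Conversely, a solution of the join satisfies all atoms of the
core (`mem_sols_of_solves`), and composing it with the homomorphism from the coloured query to the
core, which fixes the free variables, gives a substitution satisfying the query
(`exists_mem_sols_of_hasHom`). So the answers are the restrictions to the free variables of the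
solutions of an acyclic join.

To count these restrictions, let `S h` (`freeEntry`) be the set of restrictions to the free
variables of the rows of `R h` that extend to a solution of the join. If a substitution of the free
variables agrees on each `h` with a member of `S h`, it is an answer: the frontier of each component
of the core is contained in some `h`, so that a solution can be chosen for each component, and the
chosen solutions can be glued (`exists_glue`). Thus the answers are exactly the solutions of the
join of the `S h`, which is acyclic and has no projection.

Both testing whether a row extends to a solution and the final count therefore amount to counting
the solutions of an acyclic join (`countJoin`). This is done by removing ears: if a relation `e`
shares with the others only variables of one relation `f`, then the weight of each row of `f` is
multiplied by the total weight of the compatible rows of `e`, and `e` is dropped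
(`joinWeight_absorb`). Any ear can be taken, since removing an ear preserves acyclicity
(`AcyclicList.of_cons`).

Polynomial time is obtained from a calculus of polynomial-time functions between encoded types
(`PT`), closed under composition, pairing, case distinction and folds over lists whose accumulators
stay of polynomial size (`PT.foldl`). The weights are written in binary (`Bin`); they remain small
during the removal of ears because the product, over all relations, of the total weight plus one
never increases (`weightBound_earStep_le`). The views are not part of the size bound of the theorem,
but each of them is declared in the database, arities being written in unary
(`esize_views_le`).
-/

namespace CountCQ

/-! ### Functions computed by programs in polynomial time -/

/-- A type whose elements are written down as trees. -/
class Enc (α : Type) where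
  /-- the tree that encodes an element -/
  enc : α → Data

open CountCQ.Enc (enc)

instance : Enc ℕ := ⟨Data.name⟩
instance : Enc Bool := ⟨Data.ofBool⟩
instance {α β : Type} [Enc α] [Enc β] : Enc (α × β) := ⟨fun p => Data.pair (enc p.1) (enc p.2)⟩
instance {α : Type} [Enc α] : Enc (List α) := ⟨encodeList enc⟩

/-- The size of the encoding of an element. -/
def esize {α : Type} [Enc α] (a : α) : ℕ := (enc a).size

/-- `f` is computed, on encodings, by a program whose cost is polynomial in the size of its
input. The closure properties are stated for composites, so that `fun_prop` can apply them. -/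
@[fun_prop]
def PT {α β : Type} [Enc α] [Enc β] (f : α → β) : Prop :=
  ∃ (p : Prog) (P : Polynomial ℕ), ∀ a, ∃ t, t ≤ P.eval (esize a) ∧ p.Runs (enc a) (enc (f a)) t

theorem eval_mono (P : Polynomial ℕ) {m n : ℕ} (h : m ≤ n) : P.eval m ≤ P.eval n := by
  rw [Polynomial.eval_eq_sum, Polynomial.eval_eq_sum]
  exact Finset.sum_le_sum fun i _ => Nat.mul_le_mul_left _ (Nat.pow_le_pow_left h i)

theorem Data.size_left_le (x : Data) : x.left.size ≤ x.size := by
  cases x <;> simp only [Data.left, Data.size] <;> omega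

theorem Data.size_right_le (x : Data) : x.right.size ≤ x.size := by
  cases x <;> simp only [Data.right, Data.size] <;> omega

theorem Data.size_pos (x : Data) : 1 ≤ x.size := by
  cases x <;> simp only [Data.size] <;> omega

/-- Building a tree is charged at least its size. -/
theorem Prog.Runs.size_le {p : Prog} {x y : Data} {t : ℕ} (h : p.Runs x y t) : y.size ≤ t := by
  induction h with
  | id x => exact le_rfl
  | nil x => exact x.size_pos
  | left x => exact x.size_left_le
  | right x => exact x.size_right_le
  | sameName x =>
    unfold Data.sameName
    split
    · rename_i m n
      cases decide (m = n) <;> simp [Data.ofBool, Data.size]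
    · exact Data.size_pos _
  | pair _ _ ih1 ih2 => simp only [Data.size]; omega
  | seq _ _ ih1 ih2 => omega
  | ite_true _ _ _ ih1 ih2 => omega
  | ite_false _ _ ih1 ih2 => omega
  | loop_stop h ih =>
    rename_i c p x s
    -- even testing a tree once costs at least its size
    have key : ∀ (c : Prog) (x b : Data) (s : ℕ), c.Runs x b s → x.size ≤ s := by
      intro c x b s h
      induction h <;> omega
    have := key _ _ _ _ h
    omega
  | loop_step _ _ _ _ ih1 ih2 ih3 => omega

section Basic

variable {α β γ δ : Type} [Enc α] [Enc β] [Enc γ] [Enc δ]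

theorem esize_pos (a : α) : 1 ≤ esize a := Data.size_pos _

@[simp] theorem esize_mk (a : α) (b : β) : esize (a, b) = esize a + esize b + 1 := rfl

@[simp] theorem esize_nil : esize ([] : List α) = 1 := rfl

@[simp] theorem esize_cons (a : α) (l : List α) : esize (a :: l) = esize a + esize l + 1 := rfl

theorem esize_append (l m : List α) : esize (l ++ m) + 1 = esize l + esize m := by
  induction l with
  | nil => simp; omega
  | cons a l ih => simp; omega

theorem esize_le_of_mem {a : α} {l : List α} (h : a ∈ l) : esize a ≤ esize l := by
  induction l with
  | nil => simp at h
  | cons b l ih =>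
    rcases List.mem_cons.1 h with rfl | h
    · simp; omega
    · have := ih h; simp; omega

theorem length_le_esize (l : List α) : l.length + 1 ≤ esize l := by
  induction l with
  | nil => simp
  | cons b l ih => simp; omega

/-- The output of a polynomial-time function has polynomial size. -/
theorem PT.size_le {f : α → β} (hf : PT f) :
    ∃ P : Polynomial ℕ, ∀ a, esize (f a) ≤ P.eval (esize a) := by
  obtain ⟨p, P, h⟩ := hf
  refine ⟨P, fun a => ?_⟩
  obtain ⟨t, ht, hr⟩ := h a
  exact hr.size_le.trans ht

@[fun_prop] theorem PT.id : PT (fun a : α => a) :=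
  ⟨.id, .X, fun a => ⟨_, by simp [esize], .id _⟩⟩

@[fun_prop] theorem PT.comp {g : β → γ} {f : α → β} (hg : PT g) (hf : PT f) :
    PT (fun a => g (f a)) := by
  obtain ⟨p, P, hp⟩ := hf
  obtain ⟨q, R, hq⟩ := hg
  refine ⟨.seq p q, P + R.comp P + 1, fun a => ?_⟩
  obtain ⟨t, ht, hr⟩ := hp a
  obtain ⟨s, hs, hr'⟩ := hq (f a)
  refine ⟨_, ?_, .seq hr hr'⟩
  have := eval_mono R (hr.size_le.trans ht)
  simp only [Polynomial.eval_add, Polynomial.eval_comp, Polynomial.eval_one]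
  have : R.eval (esize (f a)) ≤ _ := this
  omega

@[fun_prop] theorem PT.mk {f : α → β} {g : α → γ} (hf : PT f) (hg : PT g) :
    PT (fun a => (f a, g a)) := by
  obtain ⟨p, P, hp⟩ := hf
  obtain ⟨q, R, hq⟩ := hg
  refine ⟨.pair p q, P + R + 1, fun a => ?_⟩
  obtain ⟨t, ht, hr⟩ := hp a
  obtain ⟨s, hs, hr'⟩ := hq a
  refine ⟨_, ?_, .pair hr hr'⟩
  simp only [Polynomial.eval_add, Polynomial.eval_one]
  omega

/-- A function that a program computes in a single step costing the size of its input. -/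
theorem PT.of_step {f : α → β} (p : Prog)
    (h : ∀ a, p.Runs (enc a) (enc (f a)) (enc a).size) : PT f :=
  ⟨p, .X, fun a => ⟨_, by simp [esize], h a⟩⟩

theorem PT.fst' : PT (fun p : α × β => p.1) := .of_step .left fun _ => .left _

theorem PT.snd' : PT (fun p : α × β => p.2) := .of_step .right fun _ => .right _

@[fun_prop] theorem PT.fst {f : α → β × γ} (hf : PT f) : PT (fun a => (f a).1) := PT.fst'.comp hf

@[fun_prop] theorem PT.snd {f : α → β × γ} (hf : PT f) : PT (fun a => (f a).2) := PT.snd'.comp hf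

@[fun_prop] theorem PT.ite {c : α → Bool} {f g : α → β} (hc : PT c) (hf : PT f) (hg : PT g) :
    PT (fun a => if c a then f a else g a) := by
  obtain ⟨p, P, hp⟩ := hf
  obtain ⟨q, R, hq⟩ := hg
  obtain ⟨c', S, hc⟩ := hc
  refine ⟨.ite c' p q, S + (P + R) + 1, fun a => ?_⟩
  obtain ⟨t, ht, hr⟩ := hp a
  obtain ⟨s, hs, hr'⟩ := hq a
  obtain ⟨u, hu, hc'⟩ := hc a
  simp only [Polynomial.eval_add, Polynomial.eval_one]
  cases h : c a with
  | true =>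
    rw [h] at hc'
    exact ⟨u + t + 1, by omega, .ite_true hc' (by simp [enc, Data.ofBool]) (by simpa using hr)⟩
  | false =>
    rw [h] at hc'
    exact ⟨u + s + 1, by omega, .ite_false hc' (by simpa using hr')⟩

@[fun_prop] theorem PT.const_false : PT (fun _ : α => false) := .of_step .nil fun _ => .nil _

@[fun_prop] theorem PT.const_nil : PT (fun _ : α => ([] : List β)) := .of_step .nil fun _ => .nil _

@[fun_prop] theorem PT.const_true : PT (fun _ : α => true) :=
  ⟨.pair .nil .nil, .X + .X + 1, fun a => ⟨_, by simp [esize], .pair (.nil _) (.nil _)⟩⟩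

@[fun_prop] theorem PT.cons {f : α → β} {g : α → List β} (hf : PT f) (hg : PT g) :
    PT (fun a => f a :: g a) := by
  obtain ⟨p, P, h⟩ := hf.mk hg
  exact ⟨p, P, h⟩

/-- The right subtree of a leaf is `nil`, so that the empty list is its own tail. -/
@[fun_prop] theorem PT.tail {f : α → List β} (hf : PT f) : PT (fun a => (f a).tail) := by
  refine PT.comp (g := fun l : List β => l.tail) (.of_step .right fun l => ?_) hf
  cases l <;> exact .right _

@[fun_prop] theorem PT.decide_eq {f g : α → ℕ} (hf : PT f) (hg : PT g) :
    PT (fun a => decide (f a = g a)) :=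
  PT.comp (g := fun p : ℕ × ℕ => decide (p.1 = p.2))
    (.of_step .sameName fun _ => .sameName _) (hf.mk hg)

theorem PT.congr {f g : α → β} (hf : PT f) (h : ∀ a, f a = g a) : PT g := (funext h : f = g) ▸ hf

@[fun_prop] theorem PT.isEmpty {f : α → List β} (hf : PT f) : PT (fun a => (f a).isEmpty) := by
  refine PT.comp (g := fun l : List β => l.isEmpty)
    ⟨.ite .id .nil (.pair .nil .nil), 3 * .X + 3, fun l => ?_⟩ hf
  have := esize_pos l
  cases l with
  | nil =>
    exact ⟨_, by simp [enc, encodeList, Data.size], .ite_false (.id _) (.pair (.nil _) (.nil _))⟩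
  | cons a l =>
    refine ⟨_, ?_, .ite_true (.id _) (by simp [enc, encodeList]) (.nil _)⟩
    simp only [Polynomial.eval_add, Polynomial.eval_mul, Polynomial.eval_X,
      Polynomial.eval_ofNat, esize]
    omega

/-- Case analysis on a list whose head, if there is one, is passed to `g`. -/
theorem PT.casesList {l : α → List β} {f : α → γ} {g : α → β → List β → γ} (hl : PT l)
    (hf : PT f) (hg : PT fun p : α × β × List β => g p.1 p.2.1 p.2.2) :
    PT (fun a => match l a with
      | [] => f a
      | x :: xs => g a x xs) := by
  have key : PT (fun z : α × List β => match z.2 with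
      | [] => f z.1
      | x :: xs => g z.1 x xs) := by
    obtain ⟨p, P, hp⟩ := hf.comp (PT.fst' (α := α) (β := List β))
    obtain ⟨q, R, hq⟩ := hg
    refine ⟨.ite .right q p, .X + (P + R) + 1, fun ⟨a, l⟩ => ?_⟩
    simp only [Polynomial.eval_add, Polynomial.eval_X, Polynomial.eval_one]
    cases l with
    | nil =>
      obtain ⟨t, ht, hr⟩ := hp (a, [])
      exact ⟨esize (a, ([] : List β)) + t + 1, by omega, .ite_false (.right _) hr⟩
    | cons x xs =>
      -- the encodings of `(a, x :: xs)` and of `(a, x, xs)` are the same tree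
      obtain ⟨t, ht, hr⟩ := hq (a, x, xs)
      change t ≤ R.eval (esize (a, x :: xs)) at ht
      exact ⟨esize (a, x :: xs) + t + 1, by omega,
        .ite_true (b := enc (x :: xs)) (.right _) (by simp [enc, encodeList]) hr⟩
  exact key.comp (PT.id.mk hl)

end Basic

/-! ### Iteration over lists -/

section Fold

variable {α β γ δ : Type} [Enc α] [Enc β] [Enc γ] [Enc δ]

/-- The loop of a fold whose step is computed by `p`. Its state consists of the parameter, the
accumulator and the elements still to be processed. -/
def Prog.foldLoop (p : Prog) : Prog :=
  .loop (.seq .right .right)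
    (.pair .left (.pair
      (.seq (.pair .left (.pair (.seq .right .left) (.seq (.seq .right .right) .left))) p)
      (.seq (.seq .right .right) .right)))

/-- The cost of the loop of a fold; `S` bounds the size of all states. -/
theorem runs_foldl_loop {f : α → β → γ → β} {p : Prog} {P : Polynomial ℕ}
    (hp : ∀ x : α × β × γ, ∃ t, t ≤ P.eval (esize x) ∧ p.Runs (enc x) (enc (f x.1 x.2.1 x.2.2)) t)
    (a : α) (S : ℕ) (l : List γ) (b : β)
    (hS : ∀ k, esize a + esize ((l.take k).foldl (f a) b) + esize l + 2 ≤ S) :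
    ∃ t, t ≤ (l.length + 1) * (12 * S + 12 + P.eval S) ∧
      p.foldLoop.Runs (enc (a, b, l)) (enc (a, l.foldl (f a) b, ([] : List γ))) t := by
  induction l generalizing b with
  | nil =>
    have h0 := hS 0
    simp only [List.take_nil, List.foldl_nil, esize_nil] at h0
    refine ⟨_, ?_, Prog.Runs.loop_stop (.seq (.right _) (.right _))⟩
    simp only [List.length_nil, zero_add, one_mul, enc, encodeList, Data.right, Data.size]
    simp only [esize] at h0
    omega
  | cons x l ih =>
    have h0 := hS 0
    have h1 := hS 1
    simp only [List.take_zero, List.take_succ_cons, List.foldl_cons, List.foldl_nil,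
      esize_cons] at h0 h1
    obtain ⟨t, ht, hr⟩ := hp (a, b, x)
    obtain ⟨u, hu, hr'⟩ := ih (f a b x) fun k => by
      have := hS (k + 1)
      simp only [List.take_succ_cons, List.foldl_cons, esize_cons] at this
      omega
    have hsz : esize (a, b, x) ≤ S := by simp only [esize_mk]; omega
    have := ht.trans (eval_mono P hsz)
    refine ⟨_, ?_, .loop_step (b := enc (x :: l)) (.seq (.right _) (.right _))
      (by simp [enc, encodeList])
      (.pair (.left _) (.pair (.seq (.pair (.left _) (.pair (.seq (.right _) (.left _))
        (.seq (.seq (.right _) (.right _)) (.left _)))) hr)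
        (.seq (.seq (.right _) (.right _)) (.right _)))) hr'⟩
    simp only [enc, encodeList, Data.right, Data.size, List.length_cons]
    simp only [esize] at h0
    rw [Nat.add_mul (l.length + 1)]
    have e : (encodeList enc l).size = (enc l).size := rfl
    omega

/-- A fold is computed in polynomial time if its step is and all intermediate accumulators have
polynomial size. -/
theorem PT.foldl {l : α → List γ} {b : α → β} {f : α → β → γ → β} (hl : PT l) (hb : PT b)
    (hf : PT fun p : α × β × γ => f p.1 p.2.1 p.2.2) {B : Polynomial ℕ}
    (hB : ∀ a k, esize (((l a).take k).foldl (f a) (b a)) ≤ B.eval (esize a)) :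
    PT (fun a => (l a).foldl (f a) (b a)) := by
  have hloop : PT (fun a => (a, (l a).foldl (f a) (b a), ([] : List γ))) := by
    obtain ⟨L, hL⟩ := hl.size_le
    obtain ⟨q, R, hq⟩ := PT.id.mk (hb.mk hl)
    obtain ⟨p, P, hp⟩ := hf
    refine ⟨.seq q p.foldLoop,
      R + L * (12 * (.X + B + L + 2) + 12 + P.comp (.X + B + L + 2)) + 1, fun a => ?_⟩
    obtain ⟨t, ht, hr⟩ := hq a
    obtain ⟨u, hu, hr'⟩ := runs_foldl_loop hp a
      (esize a + B.eval (esize a) + L.eval (esize a) + 2) (l a) (b a) fun k => by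
        have := hB a k
        have := hL a
        omega
    refine ⟨_, ?_, .seq hr hr'⟩
    have h1 : (l a).length + 1 ≤ L.eval (esize a) := (length_le_esize _).trans (hL a)
    have h2 := hu.trans (Nat.mul_le_mul_right _ h1)
    simp only [Polynomial.eval_add, Polynomial.eval_mul, Polynomial.eval_X, Polynomial.eval_comp,
      Polynomial.eval_ofNat, Polynomial.eval_one]
    omega
  exact hloop.snd.fst

/-- A fold each of whose steps enlarges the accumulator, as measured by `μ`, by an amount that is
polynomial in the sizes of the parameter and of the current element. -/
theorem PT.foldl_of_measure {l : α → List γ} {b : α → β} {f : α → β → γ → β} (hl : PT l)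
    (hb : PT b) (hf : PT fun p : α × β × γ => f p.1 p.2.1 p.2.2) (μ : β → ℕ) (C : ℕ)
    (hμ : ∀ b, μ b ≤ esize b) (hC : ∀ b, esize b ≤ C * μ b) (q : Polynomial ℕ)
    (hq : ∀ a b x, μ (f a b x) ≤ μ b + q.eval (esize a + esize x)) :
    PT (fun a => (l a).foldl (f a) (b a)) := by
  obtain ⟨L, hL⟩ := hl.size_le
  obtain ⟨B, hB⟩ := hb.size_le
  refine PT.foldl hl hb hf (B := .C C * (B + L * q.comp (.X + L))) fun a k => ?_
  have key : ∀ (m : List γ) (c : β), (∀ x ∈ m, x ∈ l a) →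
      μ (m.foldl (f a) c) ≤ μ c + m.length * q.eval (esize a + L.eval (esize a)) := by
    intro m
    induction m with
    | nil => intro c _; simp
    | cons x m ih =>
      intro c hm
      have h1 := ih (f a c x) fun y hy => hm y (List.mem_cons_of_mem _ hy)
      have h2 := hq a c x
      have h3 := (esize_le_of_mem (hm x (List.mem_cons_self ..))).trans (hL a)
      have h4 := eval_mono q (Nat.add_le_add_left h3 (esize a))
      simp only [List.foldl_cons, List.length_cons, Nat.add_mul, one_mul]
      omega
  have h1 := key ((l a).take k) (b a) fun x hx => List.mem_of_mem_take hx
  have h2 : ((l a).take k).length ≤ L.eval (esize a) :=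
    (List.length_take_le' k _).trans <| (Nat.le_of_succ_le (length_le_esize _)).trans (hL a)
  have h3 := Nat.mul_le_mul_right (q.eval (esize a + L.eval (esize a))) h2
  have h4 := (hμ (b a)).trans (hB a)
  simp only [Polynomial.eval_add, Polynomial.eval_mul, Polynomial.eval_X, Polynomial.eval_comp,
    Polynomial.eval_C]
  exact (hC _).trans (Nat.mul_le_mul_left _ (by omega))

/-- A fold each of whose steps enlarges the accumulator by an amount that is polynomial in the
sizes of the parameter and of the current element. -/
theorem PT.foldl_of_add {l : α → List γ} {b : α → β} {f : α → β → γ → β} (hl : PT l) (hb : PT b)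
    (hf : PT fun p : α × β × γ => f p.1 p.2.1 p.2.2) (q : Polynomial ℕ)
    (hq : ∀ a b x, esize (f a b x) ≤ esize b + q.eval (esize a + esize x)) :
    PT (fun a => (l a).foldl (f a) (b a)) :=
  PT.foldl_of_measure hl hb hf esize 1 (fun _ => le_rfl) (fun _ => (one_mul _).ge) q hq

@[fun_prop] theorem PT.reverse {l : α → List β} (hl : PT l) : PT (fun a => (l a).reverse) := by
  refine (PT.foldl_of_add (b := fun _ => []) (f := fun _ acc x => x :: acc) hl (by fun_prop)
    (by fun_prop) (.X + 1) fun a b x => ?_).congr fun a => ?_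
  · simp; omega
  · simp

@[fun_prop] theorem PT.append {l m : α → List β} (hl : PT l) (hm : PT m) :
    PT (fun a => l a ++ m a) := by
  refine (PT.foldl_of_add (f := fun _ acc x => x :: acc) hl.reverse hm
    (by fun_prop) (.X + 1) fun a b x => ?_).congr fun a => ?_
  · simp; omega
  · simp

@[fun_prop] theorem PT.flatMap {l : α → List β} {g : α → β → List γ} (hl : PT l)
    (hg : PT fun p : α × β => g p.1 p.2) : PT (fun a => (l a).flatMap (g a)) := by
  obtain ⟨q, hq⟩ := hg.size_le
  refine (PT.foldl_of_add (b := fun _ => []) (f := fun a acc x => acc ++ g a x) hl (by fun_prop)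
    (by fun_prop) (q.comp (.X + 1)) fun a b x => ?_).congr fun a => ?_
  · have h1 := esize_append b (g a x)
    have h2 := hq (a, x)
    simp only [esize_mk] at h2
    simp only [Polynomial.eval_comp, Polynomial.eval_add, Polynomial.eval_X, Polynomial.eval_one]
    omega
  · have : ∀ (m : List β) (acc : List γ),
        m.foldl (fun acc x => acc ++ g a x) acc = acc ++ m.flatMap (g a) := by
      intro m
      induction m with
      | nil => simp
      | cons x m ih => intro acc; simp [ih]
    simpa using this (l a) []

@[fun_prop] theorem PT.map {l : α → List β} {g : α → β → γ} (hl : PT l)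
    (hg : PT fun p : α × β => g p.1 p.2) : PT (fun a => (l a).map (g a)) :=
  (PT.flatMap (g := fun a x => [g a x]) hl (by fun_prop)).congr fun a =>
    (List.map_eq_flatMap).symm

@[fun_prop] theorem PT.filter {l : α → List β} {g : α → β → Bool} (hl : PT l)
    (hg : PT fun p : α × β => g p.1 p.2) : PT (fun a => (l a).filter (g a)) := by
  refine (PT.flatMap (g := fun a x => if g a x then [x] else []) hl (by fun_prop)).congr
    fun a => ?_
  induction l a with
  | nil => rfl
  | cons x l ih => by_cases h : g a x <;> simp_all

@[fun_prop] theorem PT.or {f g : α → Bool} (hf : PT f) (hg : PT g) :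
    PT (fun a => f a || g a) :=
  (PT.ite hf PT.const_true hg).congr fun a => by cases f a <;> simp

@[fun_prop] theorem PT.and {f g : α → Bool} (hf : PT f) (hg : PT g) :
    PT (fun a => f a && g a) :=
  (PT.ite hf hg PT.const_false).congr fun a => by cases f a <;> simp

@[fun_prop] theorem PT.not {f : α → Bool} (hf : PT f) : PT (fun a => !f a) :=
  (PT.ite hf PT.const_false PT.const_true).congr fun a => by cases f a <;> simp

@[fun_prop] theorem PT.any {l : α → List β} {g : α → β → Bool} (hl : PT l)
    (hg : PT fun p : α × β => g p.1 p.2) : PT (fun a => (l a).any (g a)) :=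
  (PT.filter hl hg).isEmpty.not.congr fun a => by
    induction l a with
    | nil => rfl
    | cons x l ih => by_cases h : g a x <;> simp_all

@[fun_prop] theorem PT.all {l : α → List β} {g : α → β → Bool} (hl : PT l)
    (hg : PT fun p : α × β => g p.1 p.2) : PT (fun a => (l a).all (g a)) :=
  (PT.any (g := fun a x => !g a x) hl (by fun_prop)).not.congr fun a => by
    simp [List.all_eq_not_any_not]

@[fun_prop] theorem PT.zip {l : α → List β} {m : α → List γ} (hl : PT l) (hm : PT m) :
    PT (fun a => (l a).zip (m a)) := by
  have h : PT (fun a => (l a).foldl (fun (s : List γ × List (β × γ)) x =>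
      match s.1 with
      | [] => s
      | y :: ys => (ys, (x, y) :: s.2)) (m a, [])) := by
    refine PT.foldl_of_add (f := fun _ (s : List γ × List (β × γ)) x =>
      match s.1 with
      | [] => s
      | y :: ys => (ys, (x, y) :: s.2)) hl (by fun_prop)
      (PT.casesList (l := fun p : α × (List γ × List (β × γ)) × β => p.2.1.1)
        (f := fun p => p.2.1) (g := fun p y ys => (ys, (p.2.2, y) :: p.2.1.2))
        (by fun_prop) (by fun_prop) (by fun_prop)) (.X + 2) fun a s x => ?_
    obtain ⟨s, r⟩ := s
    cases s <;> simp
    omega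
  refine h.snd.reverse.congr fun a => ?_
  have : ∀ (l : List β) (m : List γ) (r : List (β × γ)),
      (l.foldl (fun (s : List γ × List (β × γ)) x =>
        match s.1 with
        | [] => s
        | y :: ys => (ys, (x, y) :: s.2)) (m, r)).2.reverse = r.reverse ++ l.zip m := by
    intro l
    induction l with
    | nil => simp
    | cons x l ih =>
      intro m r
      cases m with
      | nil => have := ih [] r; simp_all
      | cons y m => simp [ih]
  simpa using this (l a) (m a) []

end Fold

/-! ### Binary arithmetic -/

/-- A natural number that is written in binary (whereas an element of `ℕ` is a name). -/
@[ext] structure Bin where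
  /-- the number -/
  val : ℕ

namespace Bin

/-- Numbers written in binary are numbers. -/
def equivNat : Bin ≃ ℕ := ⟨val, mk, fun _ => rfl, fun _ => rfl⟩

instance : CommSemiring Bin := equivNat.commSemiring
instance : DecidableEq Bin := equivNat.decidableEq
instance : Enc Bin := ⟨fun n => encodeNat n.val⟩

@[simp] theorem val_zero : (0 : Bin).val = 0 := rfl
@[simp] theorem val_one : (1 : Bin).val = 1 := rfl
@[simp] theorem val_add (m n : Bin) : (m + n).val = m.val + n.val := rfl
@[simp] theorem val_mul (m n : Bin) : (m * n).val = m.val * n.val := rfl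

@[simp] theorem val_natCast (n : ℕ) : (n : Bin).val = n := by
  induction n with
  | zero => simp
  | succ n ih => simp [ih]

/-- The digits of a number, least significant digit first. -/
def bits (n : Bin) : List Bool := n.val.bits

/-- The number with given digits, least significant digit first. -/
def ofBits (l : List Bool) : ℕ := l.foldr Nat.bit 0

/-- Erase the leading zeros, which are at the end of the list. -/
def normalize (l : List Bool) : List Bool :=
  l.foldr (fun b acc => if acc.isEmpty && !b then [] else b :: acc) []

@[simp] theorem ofBits_nil : ofBits [] = 0 := rfl

theorem ofBits_cons (b : Bool) (l : List Bool) : ofBits (b :: l) = 2 * ofBits l + b.toNat :=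
  Nat.bit_val _ _

theorem bits_eq_nil {n : ℕ} (h : n.bits = []) : n = 0 := by
  have := congrArg List.length h
  rw [Nat.size_eq_bits_len] at this
  exact Nat.size_eq_zero.1 (by simpa using this)

theorem bits_ofBits (l : List Bool) : (ofBits l).bits = normalize l := by
  induction l with
  | nil => rfl
  | cons b l ih =>
    have e : ofBits (b :: l) = Nat.bit b (ofBits l) := rfl
    have e' : normalize (b :: l)
      = if (normalize l).isEmpty && !b then [] else b :: normalize l := rfl
    rw [e, e', ← ih]
    generalize ofBits l = n
    by_cases hn : n = 0
    · subst hn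
      cases b <;> simp [Nat.bit]
    · rw [Nat.bits_append_bit n b (fun h => absurd h hn)]
      have : n.bits.isEmpty = false := by
        rw [Bool.eq_false_iff, Ne, List.isEmpty_iff]
        exact fun h => hn (bits_eq_nil h)
      simp [this]

theorem ofBits_bits (n : ℕ) : ofBits n.bits = n := by
  induction n using Nat.binaryRec' with
  | zero => rfl
  | bit b n h ih => rw [Nat.bits_append_bit _ _ h, ofBits_cons, ih, Nat.bit_val]

theorem esize_eq (n : Bin) : esize n = esize n.val.bits := rfl

theorem size_lt_esize (n : Bin) : n.val.size + 1 ≤ esize n := by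
  rw [esize_eq, ← Nat.size_eq_bits_len]
  exact length_le_esize _

theorem esize_le (n : Bin) : esize n ≤ 4 * n.val.size + 1 := by
  rw [esize_eq, ← Nat.size_eq_bits_len]
  induction n.val.bits with
  | nil => simp
  | cons b l ih =>
    have : esize b ≤ 3 := by cases b <;> simp [esize, enc, Data.ofBool, Data.size]
    simp only [esize_cons, List.length_cons]
    omega

end Bin

section

variable {α : Type} [Enc α]

/-- A number and the list of its digits are encoded by the same tree. -/
@[fun_prop] theorem PT.bits {f : α → Bin} (hf : PT f) : PT (fun a => (f a).bits) :=
  PT.comp (g := Bin.bits) (.of_step .id fun n => .id (enc n)) hf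

/-- The left subtree of a leaf is `nil`, which also encodes `false`. -/
@[fun_prop] theorem PT.headD {f : α → List Bool} (hf : PT f) : PT (fun a => (f a).headD false) :=
  PT.comp (g := fun l : List Bool => l.headD false)
    (.of_step .left fun l => by cases l <;> exact .left _) hf

@[fun_prop] theorem PT.normalize {f : α → List Bool} (hf : PT f) :
    PT (fun a => Bin.normalize (f a)) := by
  refine (PT.foldl_of_add (b := fun _ => [])
    (f := fun _ acc b => if acc.isEmpty && !b then [] else b :: acc) hf.reverse
    (by fun_prop) (by fun_prop) (.X + 1) fun a b x => ?_).congr fun a => ?_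
  · have := esize_pos b
    split <;> simp <;> omega
  · rw [List.foldl_reverse]; rfl

@[fun_prop] theorem PT.ofBits {f : α → List Bool} (hf : PT f) :
    PT (fun a => (⟨Bin.ofBits (f a)⟩ : Bin)) := by
  obtain ⟨p, P, h⟩ := hf.normalize
  refine ⟨p, P, fun a => ?_⟩
  obtain ⟨t, ht, hr⟩ := h a
  simp only [← Bin.bits_ofBits] at hr
  exact ⟨t, ht, hr⟩

namespace Bin

/-- One step of the addition of two numbers. The state consists of the remaining digits of the two
numbers, the carry and the digits of the sum found so far, the last one first. -/
def addStep (s : List Bool × List Bool × Bool × List Bool) :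
    List Bool × List Bool × Bool × List Bool :=
  (s.1.tail, s.2.1.tail,
    (s.1.headD false && s.2.1.headD false) ||
      ((s.1.headD false || s.2.1.headD false) && s.2.2.1),
    (if s.1.headD false then (if s.2.1.headD false then s.2.2.1 else !s.2.2.1)
      else (if s.2.1.headD false then !s.2.2.1 else s.2.2.1)) :: s.2.2.2)

theorem ofBits_append (l m : List Bool) :
    ofBits (l ++ m) = ofBits l + 2 ^ l.length * ofBits m := by
  induction l with
  | nil => simp
  | cons b l ih =>
    rw [List.cons_append, ofBits_cons, ih, ofBits_cons, List.length_cons, pow_succ]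
    ring

theorem ofBits_head_tail (l : List Bool) :
    ofBits l = 2 * ofBits l.tail + (l.headD false).toNat := by
  cases l with
  | nil => rfl
  | cons b l => exact ofBits_cons b l

/-- The number that is represented by a state of the addition. -/
def stateValue (s : List Bool × List Bool × Bool × List Bool) : ℕ :=
  ofBits s.2.2.2.reverse + 2 ^ s.2.2.2.length * (ofBits s.1 + ofBits s.2.1 + s.2.2.1.toNat)

theorem stateValue_addStep (s : List Bool × List Bool × Bool × List Bool) :
    stateValue (addStep s) = stateValue s := by
  obtain ⟨x, y, c, o⟩ := s
  simp only [stateValue]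
  rw [ofBits_head_tail x, ofBits_head_tail y]
  simp only [addStep, List.reverse_cons, List.length_cons]
  rw [ofBits_append, ofBits_cons, List.length_reverse, pow_succ]
  generalize x.headD false = a
  generalize y.headD false = b
  cases a <;> cases b <;> cases c <;> simp <;> ring

theorem stateValue_addSteps {γ : Type} (l : List γ)
    (s : List Bool × List Bool × Bool × List Bool)
    (h1 : s.1.length ≤ l.length) (h2 : s.2.1.length ≤ l.length) :
    ofBits ((l.foldl (fun s _ => addStep s) s).2.2.1 ::
      (l.foldl (fun s _ => addStep s) s).2.2.2).reverse = stateValue s := by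
  induction l generalizing s with
  | nil =>
    obtain ⟨x, y, c, o⟩ := s
    obtain rfl : x = [] := by simpa using h1
    obtain rfl : y = [] := by simpa using h2
    simp only [List.foldl_nil, List.reverse_cons, stateValue]
    rw [ofBits_append, ofBits_cons]
    simp
  | cons z l ih =>
    rw [List.foldl_cons, ← stateValue_addStep s]
    apply ih
    · simp only [addStep, List.length_tail]
      simp only [List.length_cons] at h1
      omega
    · simp only [addStep, List.length_tail]
      simp only [List.length_cons] at h2
      omega

/-- The final state of the addition. The list `x ++ y` only serves to make enough steps. -/
def addSteps (x y : List Bool) : List Bool × List Bool × Bool × List Bool :=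
  (x ++ y).foldl (fun s _ => addStep s) (x, y, false, [])

theorem add_eq (m n : Bin) : m + n =
    ⟨ofBits ((addSteps m.bits n.bits).2.2.1 :: (addSteps m.bits n.bits).2.2.2).reverse⟩ := by
  ext
  have h := stateValue_addSteps (m.bits ++ n.bits) (m.bits, n.bits, false, [])
    (by simp) (by simp)
  rw [addSteps, h, stateValue]
  simp [bits, ofBits_bits]

end Bin

@[fun_prop] theorem PT.add {f g : α → Bin} (hf : PT f) (hg : PT g) : PT (fun a => f a + g a) := by
  have h : PT (fun p : List Bool × List Bool => Bin.addSteps p.1 p.2) := by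
    refine PT.foldl_of_add (f := fun _ s _ => Bin.addStep s) (by fun_prop) (by fun_prop)
      (by unfold Bin.addStep; fun_prop) 20 fun a s x => ?_
    obtain ⟨x, y, c, o⟩ := s
    have h1 : ∀ b : Bool, 1 ≤ esize b ∧ esize b ≤ 3 := by
      intro b; cases b <;> simp [esize, enc, Data.ofBool, Data.size]
    have h2 : ∀ l : List Bool, esize l.tail ≤ esize l := by
      intro l; cases l <;> simp; omega
    have := h2 x
    have := h2 y
    have := h1 c
    have := h1 (Bin.addStep (x, y, c, o)).2.2.1
    have := h1 ((Bin.addStep (x, y, c, o)).2.2.2.headD false)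
    simp only [Bin.addStep, esize_mk, esize_cons, Polynomial.eval_ofNat, List.headD_cons] at *
    omega
  have h' := h.comp (hf.bits.mk hg.bits)
  exact (PT.ofBits (by fun_prop)).congr fun a => (Bin.add_eq (f a) (g a)).symm

@[fun_prop] theorem PT.zero : PT (fun _ : α => (0 : Bin)) :=
  (PT.ofBits (f := fun _ : α => []) (by fun_prop)).congr fun _ => rfl

@[fun_prop] theorem PT.one : PT (fun _ : α => (1 : Bin)) :=
  (PT.ofBits (f := fun _ : α => [true]) (by fun_prop)).congr fun _ => rfl

theorem size_add_le (m n : ℕ) : (m + n).size ≤ m.size + n.size + 1 := by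
  rw [Nat.size_le, pow_succ, pow_add]
  have h1 := Nat.lt_size_self m
  have h2 := Nat.lt_size_self n
  nlinarith [Nat.mul_le_mul (Nat.one_le_two_pow (n := m.size)) h2.le,
    Nat.mul_le_mul h1.le (Nat.one_le_two_pow (n := n.size)),
    Nat.one_le_two_pow (n := n.size), Nat.one_le_two_pow (n := m.size)]

/-- A fold with values in `Bin` whose steps add few digits. -/
theorem PT.foldlBin {β : Type} [Enc β] {l : α → List β} {b : α → Bin} {f : α → Bin → β → Bin}
    (hl : PT l) (hb : PT b) (hf : PT fun p : α × Bin × β => f p.1 p.2.1 p.2.2) (q : Polynomial ℕ)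
    (hq : ∀ a b x, (f a b x).val.size ≤ b.val.size + q.eval (esize a + esize x)) :
    PT (fun a => (l a).foldl (f a) (b a)) :=
  PT.foldl_of_measure hl hb hf (fun n => n.val.size + 1) 4 Bin.size_lt_esize
    (fun n => (Bin.esize_le n).trans (by omega)) q (fun a b x => by have := hq a b x; omega)

@[fun_prop] theorem PT.sum {l : α → List Bin} (hl : PT l) : PT (fun a => (l a).sum) := by
  refine (PT.foldlBin (b := fun _ => 0) (f := fun _ s x => s + x) hl (by fun_prop)
    (by fun_prop) (.X + 1) fun a s x => ?_).congr fun a => List.sum_eq_foldl.symm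
  have := size_add_le s.val x.val
  have := Bin.size_lt_esize x
  simp only [Polynomial.eval_add, Polynomial.eval_X, Polynomial.eval_one, Bin.val_add]
  omega

/-- Multiplication, by Horner's rule. -/
theorem Bin.mul_eq (m n : Bin) :
    m * n = m.bits.reverse.foldl (fun s b => if b then s + s + n else s + s) 0 := by
  rw [List.foldl_reverse]
  have : ∀ l, (⟨ofBits l⟩ : Bin) * n = l.foldr (fun b s => if b then s + s + n else s + s) 0 := by
    intro l
    induction l with
    | nil => exact zero_mul n
    | cons b l ih =>
      rw [List.foldr_cons, ← ih]
      ext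
      cases b <;> simp [ofBits_cons] <;> ring
  rw [← this, bits, ofBits_bits]

@[fun_prop] theorem PT.mul {f g : α → Bin} (hf : PT f) (hg : PT g) : PT (fun a => f a * g a) := by
  have h : PT (fun p : Bin × Bin =>
      p.1.bits.reverse.foldl (fun s b => if b then s + s + p.2 else s + s) 0) := by
    refine PT.foldlBin (l := fun p : Bin × Bin => p.1.bits.reverse) (b := fun _ => 0)
      (f := fun p s b => if b then s + s + p.2 else s + s) (by fun_prop) (by fun_prop)
      (by fun_prop) (.X + 2) fun p s b => ?_
    have h1 := size_add_le (s.val + s.val) p.2.val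
    have h2 : (s.val + s.val).size ≤ s.val.size + 1 := by
      rw [Nat.size_le, pow_succ]
      have := Nat.lt_size_self s.val
      omega
    have h3 := Bin.size_lt_esize p.2
    have h4 : esize p = esize p.1 + esize p.2 + 1 := rfl
    simp only [Polynomial.eval_add, Polynomial.eval_X, Polynomial.eval_ofNat]
    cases b <;> simp <;> omega
  exact (h.comp (hf.mk hg)).congr fun a => (Bin.mul_eq _ _).symm

@[fun_prop] theorem PT.decide_eq_zero {f : α → Bin} (hf : PT f) :
    PT (fun a => decide (f a = 0)) :=
  hf.bits.isEmpty.congr fun a => by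
    rw [Bool.eq_iff_iff, List.isEmpty_iff, decide_eq_true_iff]
    constructor
    · exact fun h => Bin.ext (Bin.bits_eq_nil h)
    · intro h
      rw [h]
      exact Nat.zero_bits

end

/-! ### Acyclic lists of hyperedges -/

/-- The union of a list of sets. -/
def unionOf (l : List (Set ℕ)) : Set ℕ := {x | ∃ e ∈ l, x ∈ e}

/-- `e` is an ear of `l`: some member of `l` contains all nodes that `e` shares with members
of `l`. -/
def IsEar (e : Set ℕ) (l : List (Set ℕ)) : Prop := ∃ f ∈ l, ∀ x ∈ e, x ∈ unionOf l → x ∈ f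

/-- The running intersection property: every member but the last one is an ear of the members that
follow it. -/
def RunningIntersection : List (Set ℕ) → Prop
  | [] => True
  | e :: l => RunningIntersection l ∧ (l = [] ∨ IsEar e l)

/-- A list of hyperedges (with multiplicities) that has the running intersection property in some
order. For the hyperedges of a hypergraph, this amounts to acyclicity. -/
def AcyclicList (l : List (Set ℕ)) : Prop := ∃ m, m.Perm l ∧ RunningIntersection m

theorem unionOf_cons {e : Set ℕ} {l : List (Set ℕ)} {x : ℕ} :
    x ∈ unionOf (e :: l) ↔ x ∈ e ∨ x ∈ unionOf l := by
  simp [unionOf]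

theorem unionOf_perm {l m : List (Set ℕ)} (h : l.Perm m) : unionOf l = unionOf m := by
  ext x; simp [unionOf, h.mem_iff]

theorem IsEar.perm {e : Set ℕ} {l m : List (Set ℕ)} (he : IsEar e l) (h : l.Perm m) :
    IsEar e m := by
  obtain ⟨f, hf, H⟩ := he
  exact ⟨f, h.mem_iff.1 hf, unionOf_perm h ▸ H⟩

theorem IsEar.of_mem {e : Set ℕ} {l : List (Set ℕ)} (h : e ∈ l) : IsEar e l :=
  ⟨e, h, fun _ hx _ => hx⟩

theorem AcyclicList.perm {l m : List (Set ℕ)} (h : AcyclicList l) (hp : l.Perm m) :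
    AcyclicList m := by
  obtain ⟨k, hk, H⟩ := h
  exact ⟨k, hk.trans hp, H⟩

theorem AcyclicList.cons {e : Set ℕ} {l : List (Set ℕ)} (h : AcyclicList l) (he : IsEar e l) :
    AcyclicList (e :: l) := by
  obtain ⟨k, hk, H⟩ := h
  exact ⟨e :: k, hk.cons e, H, .inr (he.perm hk.symm)⟩

theorem RunningIntersection.map_inter {l : List (Set ℕ)} (h : RunningIntersection l)
    (W : Set ℕ) : RunningIntersection (l.map (· ∩ W)) := by
  induction l with
  | nil => trivial
  | cons e l ih =>
    refine ⟨ih h.1, ?_⟩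
    rcases h.2 with rfl | ⟨f, hf, H⟩
    · exact .inl rfl
    · refine .inr ⟨f ∩ W, List.mem_map_of_mem hf, fun x hx hx' => ⟨H x hx.1 ?_, hx.2⟩⟩
      obtain ⟨g, hg, hxg⟩ := hx'
      obtain ⟨g, hg', rfl⟩ := List.mem_map.1 hg
      exact ⟨g, hg', hxg.1⟩

theorem AcyclicList.map_inter {l : List (Set ℕ)} (h : AcyclicList l) (W : Set ℕ) :
    AcyclicList (l.map (· ∩ W)) := by
  obtain ⟨k, hk, H⟩ := h
  exact ⟨_, hk.map _, H.map_inter W⟩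

theorem AcyclicList.exists_isEar {l : List (Set ℕ)} (h : AcyclicList l) (hl : 2 ≤ l.length) :
    ∃ e m, l.Perm (e :: m) ∧ IsEar e m := by
  obtain ⟨k, hk, H⟩ := h
  match k, H with
  | [], _ => simp [← hk.length_eq] at hl
  | e :: m, H =>
    rcases H.2 with rfl | he
    · simp [← hk.length_eq] at hl
    · exact ⟨e, m, hk.symm, he⟩

theorem RunningIntersection.replace {s t : List (Set ℕ)} {e a : Set ℕ}
    (h : RunningIntersection (s ++ e :: t))
    (hea : ∀ x ∈ unionOf (s ++ t), x ∈ e ↔ x ∈ a) : RunningIntersection (s ++ a :: t) := by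
  induction s with
  | nil =>
    refine ⟨h.1, h.2.imp id ?_⟩
    rintro ⟨f, hf, H⟩
    exact ⟨f, hf, fun x hx hx' => H x ((hea x hx').2 hx) hx'⟩
  | cons y s ih =>
    refine ⟨ih h.1 fun x hx => hea x (unionOf_cons.2 (.inr hx)), .inr ?_⟩
    change IsEar y (s ++ a :: t)
    obtain ⟨f, hf, H⟩ : IsEar y (s ++ e :: t) :=
      (show s ++ e :: t = [] ∨ IsEar y (s ++ e :: t) from h.2).resolve_left (by simp)
    have H' : ∀ x ∈ y, x ∈ unionOf (s ++ a :: t) → x ∈ f := by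
      rintro x hx ⟨g, hg, hxg⟩
      refine H x hx ?_
      simp only [List.mem_append, List.mem_cons] at hg
      by_cases hga : g = a
      · exact ⟨e, by simp, (hea x ⟨y, by simp, hx⟩).2 (hga ▸ hxg)⟩
      · exact ⟨g, by simp only [List.mem_append, List.mem_cons]; tauto, hxg⟩
    simp only [List.mem_append, List.mem_cons] at hf
    by_cases hfe : f = e
    · exact ⟨a, by simp, fun x hx hx' => (hea x ⟨y, by simp, hx⟩).1 (hfe ▸ H' x hx hx')⟩
    · exact ⟨f, by simp only [List.mem_append, List.mem_cons]; tauto, H'⟩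

/-- In an acyclic list, a member can be replaced by one that has the same nodes in common with the
other members. -/
theorem AcyclicList.replace {l : List (Set ℕ)} {e a : Set ℕ} (h : AcyclicList (e :: l))
    (hea : ∀ x ∈ unionOf l, x ∈ e ↔ x ∈ a) : AcyclicList (a :: l) := by
  obtain ⟨k, hk, H⟩ := h
  obtain ⟨s, t, rfl⟩ := List.append_of_mem (hk.mem_iff.2 (List.mem_cons_self ..))
  have hp : (s ++ t).Perm l := (List.perm_middle.symm.trans hk).cons_inv
  exact ⟨s ++ a :: t, List.perm_middle.trans (hp.cons a),
    H.replace fun x hx => hea x (unionOf_perm hp ▸ hx)⟩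

/-- Removing an arbitrary ear preserves acyclicity, so that ears can be removed greedily. -/
theorem AcyclicList.of_cons {e : Set ℕ} {m : List (Set ℕ)} (h : AcyclicList (e :: m))
    (he : IsEar e m) : AcyclicList m := by
  obtain ⟨k, hk, H⟩ := h
  induction k generalizing e m with
  | nil => simp at hk
  | cons a r ih =>
    by_cases hae : a = e
    · subst hae
      exact ⟨r, hk.cons_inv, H.1⟩
    -- in the order `a :: r`, the ear `e` occurs in `r`
    have her : e ∈ r := by
      have := hk.mem_iff.2 (List.mem_cons_self ..)
      simpa [Ne.symm hae] using this
    obtain ⟨s, t, rfl⟩ := List.append_of_mem her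
    have hr : (s ++ e :: t).Perm (e :: (s ++ t)) := List.perm_middle
    have hm : (a :: (s ++ t)).Perm m :=
      ((List.Perm.swap a e _).trans ((hr.symm.cons a).trans hk)).cons_inv
    have har : IsEar a (e :: (s ++ t)) := (H.2.resolve_left (by simp)).perm hr
    have her' : IsEar e (a :: (s ++ t)) := he.perm hm.symm
    have hac : AcyclicList (e :: (s ++ t)) := ⟨_, hr, H.1⟩
    replace ih := fun h' => ih (e := e) (m := s ++ t) h' hr H.1
    refine AcyclicList.perm ?_ hm
    generalize s ++ t = r at *
    obtain ⟨b, hb, Hb⟩ := har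
    obtain ⟨f, hf, Hf⟩ := her'
    have hU : ∀ (y : Set ℕ) x, x ∈ unionOf r → x ∈ unionOf (y :: r) :=
      fun y x hx => unionOf_cons.2 (.inr hx)
    rcases List.mem_cons.1 hf with rfl | hf
    · rcases List.mem_cons.1 hb with rfl | hb
      · -- `a` and `e` witness each other: they have the same nodes in common with the others
        exact hac.replace fun x hx => ⟨fun h => Hf x h (hU _ x hx), fun h => Hb x h (hU _ x hx)⟩
      · exact (ih ⟨b, hb, fun x hx hx' =>
          Hb x (Hf x hx (hU _ x hx')) (hU _ x hx')⟩).cons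
          ⟨b, hb, fun x hx hx' => Hb x hx (hU _ x hx')⟩
    · refine (ih ⟨f, hf, fun x hx hx' => Hf x hx (hU _ x hx')⟩).cons ?_
      rcases List.mem_cons.1 hb with rfl | hb
      · exact ⟨f, hf, fun x hx hx' => Hf x (Hb x hx (hU _ x hx')) (hU _ x hx')⟩
      · exact ⟨b, hb, fun x hx hx' => Hb x hx (hU _ x hx')⟩

/-- Acyclicity of a list only depends on the set of its members. -/
theorem AcyclicList.of_mem_iff {l m : List (Set ℕ)} (h : AcyclicList l)
    (hlm : ∀ e, e ∈ l ↔ e ∈ m) : AcyclicList m := by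
  have h1 : ∀ k : List (Set ℕ), (∀ e ∈ k, e ∈ l) → AcyclicList (k ++ l) := by
    intro k
    induction k with
    | nil => exact fun _ => h
    | cons e k ih =>
      intro hk
      exact (ih fun x hx => hk x (List.mem_cons_of_mem _ hx)).cons
        (.of_mem (List.mem_append_right _ (hk e (List.mem_cons_self ..))))
  have h2 : ∀ k : List (Set ℕ), (∀ e ∈ k, e ∈ m) → AcyclicList (k ++ m) → AcyclicList m := by
    intro k
    induction k with
    | nil => exact fun _ h => h
    | cons e k ih =>
      intro hk h
      exact ih (fun x hx => hk x (List.mem_cons_of_mem _ hx)) (h.of_cons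
        (.of_mem (List.mem_append_right _ (hk e (List.mem_cons_self ..)))))
  exact h2 l (fun e he => (hlm e).1 he) ((h1 m fun e he => (hlm e).2 he).perm
    List.perm_append_comm)

/-- Removing leaves from a join tree, one after the other, lists its vertices in an order that has
the running intersection property. -/
theorem exists_runningIntersection {V : Type} [Finite V] (T : SimpleGraph V) (hT : T.IsTree)
    (E : V → Set ℕ) (hE : ∀ (u v : V) (x : ℕ), x ∈ E u → x ∈ E v →
      ∀ p : T.Walk u v, p.IsPath → ∀ w ∈ p.support, x ∈ E w) :
    ∃ l : List V, (∀ v, v ∈ l) ∧ RunningIntersection (l.map E) := by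
  classical
  induction h : Nat.card V using Nat.strong_induction_on generalizing V with
  | _ n ih =>
  have := Fintype.ofFinite V
  rcases subsingleton_or_nontrivial V with hV | hV
  · obtain ⟨v⟩ := hT.1.nonempty
    exact ⟨[v], fun w => by simp [Subsingleton.elim w v], trivial, .inl rfl⟩
  · obtain ⟨v, hv⟩ := hT.exists_vert_degree_one_of_nontrivial
    obtain ⟨b, hvb, hb⟩ := SimpleGraph.degree_eq_one_iff_existsUnique_adj.1 hv
    have hT' : (T.induce {v}ᶜ).IsTree :=
      ⟨hT.1.induce_compl_singleton_of_degree_eq_one hv, hT.2.induce _⟩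
    obtain ⟨l, hl, hl'⟩ := ih (Nat.card ({v}ᶜ : Set V))
      (by
        rw [← h, ← Set.ncard_univ V, Nat.card_coe_set_eq]
        exact Set.ncard_lt_ncard ⟨Set.subset_univ _, fun hh => hh (Set.mem_univ v) rfl⟩)
      (T.induce {v}ᶜ) hT' (fun u => E u) (by
        intro u w x hu hw p hp y hy
        let i := (SimpleGraph.Embedding.induce (G := T) ({v}ᶜ : Set V))
        exact hE u w x hu hw (p.map i.toHom) (hp.map i.injective) y
          ((SimpleGraph.Walk.support_map i.toHom p).symm ▸ List.mem_map_of_mem hy)) rfl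
    have hmap : (l.map Subtype.val).map E = l.map fun u : ({v}ᶜ : Set V) => E u := by
      rw [List.map_map]; rfl
    have hmem : ∀ u, u ≠ v → u ∈ l.map Subtype.val := fun u hu =>
      List.mem_map.2 ⟨⟨u, hu⟩, hl _, rfl⟩
    refine ⟨v :: l.map Subtype.val, fun u => ?_, ?_, .inr ⟨E b, ?_, ?_⟩⟩
    · by_cases hu : u = v
      · simp [hu]
      · exact List.mem_cons_of_mem _ (hmem u hu)
    · rw [hmap]
      exact hl'
    · exact List.mem_map_of_mem (hmem b hvb.ne')
    · rintro x hx ⟨_, hg, hxg⟩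
      obtain ⟨u, hu, rfl⟩ := List.mem_map.1 hg
      obtain ⟨⟨u, huv⟩, -, rfl⟩ := List.mem_map.1 hu
      -- a path that leaves the leaf `v` passes through its neighbour `b`
      obtain ⟨p, hp⟩ := (hT.1.preconnected v u).exists_isPath
      refine hE v u x hx hxg p hp b ?_
      cases p with
      | nil => exact absurd rfl huv
      | cons hadj q =>
        obtain rfl := hb _ hadj
        simp

/-- The hyperedges of an acyclic hypergraph, listed in an arbitrary way, form an acyclic list. -/
theorem IsAcyclic.acyclicList {L : HypergraphList} (h : IsAcyclic L.toHypergraph) :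
    AcyclicList (L.edges.map fun l => {x | x ∈ l}) := by
  obtain ⟨T, hT, hE⟩ := h
  have hfin : L.toHypergraph.edgeSet.Finite := by
    refine (List.finite_toSet (L.edges.map fun l => {x | x ∈ l})).subset ?_
    rintro e ⟨l, hl, rfl⟩
    exact List.mem_map.2 ⟨l, hl, rfl⟩
  have := hfin.to_subtype
  obtain ⟨l, hl, hl'⟩ := exists_runningIntersection T hT (fun e => e.1) hE
  refine AcyclicList.of_mem_iff ⟨_, .refl _, hl'⟩ fun e => ?_
  simp only [List.mem_map]
  constructor
  · rintro ⟨⟨_, l', hl', rfl⟩, -, rfl⟩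
    exact ⟨l', hl', rfl⟩
  · rintro ⟨l', hl', rfl⟩
    exact ⟨⟨_, l', hl', rfl⟩, hl _, rfl⟩

/-! ### Rows and joins -/

/-- A substitution for finitely many variables, as a list of variables with their values. -/
abbrev Row := List (ℕ × ℕ)

/-- Two rows do not assign different values to a variable. -/
def compat (r s : Row) : Bool :=
  r.all fun p => s.all fun q => !decide (p.1 = q.1) || decide (p.2 = q.2)

/-- The total substitution `θ` extends the row `r`. -/
def Extends (θ : ℕ → ℕ) (r : Row) : Prop := ∀ x c, (x, c) ∈ r → θ x = c

/-- The variables to which a row assigns a value. -/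
def keys (r : Row) : Set ℕ := {x | ∃ c, (x, c) ∈ r}

/-- `r` is a row that assigns one value to every variable in `e`, and nothing else. -/
def IsRowOn (e : Set ℕ) (r : Row) : Prop := keys r = e ∧ compat r r = true

theorem compat_iff {r s : Row} :
    compat r s = true ↔ ∀ x c d, (x, c) ∈ r → (x, d) ∈ s → c = d := by
  simp only [compat, List.all_eq_true, Prod.forall, Bool.or_eq_true, Bool.not_eq_true',
    decide_eq_false_iff_not, decide_eq_true_eq]
  constructor
  · intro h x c d hc hd
    exact (h x c hc x d hd).resolve_left (fun h => h rfl)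
  · intro h x c hc y d hd
    by_cases hxy : x = y
    · subst hxy
      exact .inr (h x c d hc hd)
    · exact .inl hxy

theorem compat_append_right {r s t : Row} :
    compat r (s ++ t) = true ↔ compat r s = true ∧ compat r t = true := by
  simp only [compat_iff, List.mem_append]
  grind

theorem compat_comm {r s : Row} : compat r s = true ↔ compat s r = true := by
  simp only [compat_iff]
  grind

theorem compat_of_extends {θ : ℕ → ℕ} {r s : Row} (hr : Extends θ r) (hs : Extends θ s) :
    compat r s = true :=
  compat_iff.2 fun x c d hc hd => (hr x c hc).symm.trans (hs x d hd)

/-- The value that a row assigns to a variable. -/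
def rowValue (r : Row) (x : ℕ) : ℕ := ((r.find? fun p => p.1 = x).map Prod.snd).getD 0

theorem extends_rowValue {r : Row} (h : compat r r = true) : Extends (rowValue r) r := by
  intro x c hc
  cases hf : r.find? fun p => p.1 = x with
  | none => exact absurd (List.find?_eq_none.1 hf _ hc) (by simp)
  | some q =>
    have h1 := List.mem_of_find?_eq_some hf
    have h2 : q.1 = x := by simpa using List.find?_some hf
    rw [rowValue, hf]
    obtain ⟨y, d⟩ := q
    obtain rfl : y = x := h2
    exact compat_iff.1 h _ _ _ h1 hc

/-- A relation over a list of variables: weighted rows. -/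
abbrev Entry (K : Type) := List ℕ × List (Row × K)

section Join

variable {K : Type}

/-- The set of variables of a relation. -/
def edgeOf (e : Entry K) : Set ℕ := {x | x ∈ e.1}

/-- The variables of a list of relations. -/
def nodesOf (F : List (Entry K)) : Set ℕ := unionOf (F.map edgeOf)

theorem mem_nodesOf {F : List (Entry K)} {x : ℕ} : x ∈ nodesOf F ↔ ∃ e ∈ F, x ∈ e.1 := by
  simp [nodesOf, unionOf, edgeOf]

/-- The rows of each relation assign values to the variables of the relation. -/
def WellFormed (F : List (Entry K)) : Prop := ∀ e ∈ F, ∀ t ∈ e.2, IsRowOn (edgeOf e) t.1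

theorem WellFormed.perm {F G : List (Entry K)} (hF : WellFormed F) (h : F.Perm G) :
    WellFormed G := fun e he => hF e (h.mem_iff.2 he)

/-- The join of a list of relations, restricted to the rows that are compatible with `r`. -/
def joinRows : List (Entry K) → Row → List Row
  | [], r => [r]
  | e :: F, r => e.2.flatMap fun t => if compat t.1 r then joinRows F (t.1 ++ r) else []

/-- A substitution extends a row of the join if and only if it extends a row of each relation. -/
theorem exists_joinRows {θ : ℕ → ℕ} {F : List (Entry K)} {r : Row} :
    (∃ s ∈ joinRows F r, Extends θ s) ↔
      Extends θ r ∧ ∀ e ∈ F, ∃ t ∈ e.2, Extends θ t.1 := by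
  induction F generalizing r with
  | nil => simp [joinRows]
  | cons e F ih =>
    constructor
    · rintro ⟨s, hs, hθ⟩
      obtain ⟨t, ht, hs⟩ := List.mem_flatMap.1 hs
      split at hs
      · obtain ⟨h1, h2⟩ := ih.1 ⟨s, hs, hθ⟩
        refine ⟨fun x c h => h1 x c (List.mem_append_right _ h), ?_⟩
        intro e' he'
        rcases List.mem_cons.1 he' with rfl | he'
        · exact ⟨t, ht, fun x c h => h1 x c (List.mem_append_left _ h)⟩
        · exact h2 e' he'
      · simp at hs
    · rintro ⟨hr, hF⟩
      obtain ⟨t, ht, hθ⟩ := hF e (List.mem_cons_self ..)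
      obtain ⟨s, hs, hs'⟩ := (ih (r := t.1 ++ r)).2 ⟨fun x c h =>
        (List.mem_append.1 h).elim (hθ x c) (hr x c),
        fun e' he' => hF e' (List.mem_cons_of_mem _ he')⟩
      refine ⟨s, List.mem_flatMap.2 ⟨t, ht, ?_⟩, hs'⟩
      rw [if_pos (compat_of_extends hθ hr)]
      exact hs

theorem joinRows_isRowOn {F : List (Entry K)} (hF : WellFormed F) {r : Row} {U : Set ℕ}
    (hr : IsRowOn U r) {s : Row} (hs : s ∈ joinRows F r) : IsRowOn (nodesOf F ∪ U) s := by
  induction F generalizing r U with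
  | nil =>
    obtain rfl : s = r := by simpa [joinRows] using hs
    simpa [nodesOf, unionOf] using hr
  | cons e F ih =>
    obtain ⟨t, ht, hs⟩ := List.mem_flatMap.1 hs
    split at hs
    · rename_i hc
      have hte := hF e (List.mem_cons_self ..) t ht
      have h1 : IsRowOn (edgeOf e ∪ U) (t.1 ++ r) := by
        constructor
        · rw [← hte.1, ← hr.1]
          ext x
          simp [keys, exists_or]
        · have hte' := hte.2
          have hr' := hr.2
          simp only [compat_iff, List.mem_append] at *
          grind
      have h2 := ih (fun e' he' => hF e' (List.mem_cons_of_mem _ he')) h1 hs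
      convert h2 using 1
      ext x
      simp only [nodesOf, List.map_cons, Set.mem_union, unionOf_cons]
      tauto
    · simp at hs

theorem mem_of_mem_joinRows {F : List (Entry K)} {r s : Row} (hs : s ∈ joinRows F r) :
    ∀ p ∈ r, p ∈ s := by
  induction F generalizing r with
  | nil =>
    obtain rfl : s = r := by simpa [joinRows] using hs
    exact fun _ h => h
  | cons e F ih =>
    obtain ⟨t, ht, hs⟩ := List.mem_flatMap.1 hs
    split at hs
    · exact fun p hp => ih hs p (List.mem_append_right _ hp)
    · simp at hs

/-- If distinct rows of each relation are incompatible, then so are distinct rows of the join. -/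
theorem pairwise_joinRows {F : List (Entry K)}
    (hF : ∀ e ∈ F, e.2.Pairwise fun t s => compat t.1 s.1 = false) (r : Row) :
    (joinRows F r).Pairwise fun t s => compat t s = false := by
  induction F generalizing r with
  | nil => simp [joinRows]
  | cons e F ih =>
    rw [joinRows, List.pairwise_flatMap]
    constructor
    · intro t ht
      split
      · exact ih (fun e' he' => hF e' (List.mem_cons_of_mem _ he')) _
      · exact List.Pairwise.nil
    · refine (hF e (List.mem_cons_self ..)).imp ?_
      intro t s hts u hu v hv
      split at hu
      · split at hv
        · have h1 := mem_of_mem_joinRows hu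
          have h2 := mem_of_mem_joinRows hv
          rw [Bool.eq_false_iff] at hts ⊢
          intro h
          refine hts (compat_iff.2 fun x c d hc hd => compat_iff.1 h x c d ?_ ?_)
          · exact h1 _ (List.mem_append_left _ hc)
          · exact h2 _ (List.mem_append_left _ hd)
        · simp at hv
      · simp at hu

/-- Does `f` contain all variables that `e` shares with the relations in `F`? -/
def isWitness (e : Entry K) (F : List (Entry K)) (f : Entry K) : Bool :=
  e.1.all fun x => (f.1.any fun y => decide (x = y)) ||
    !(F.any fun g => g.1.any fun y => decide (x = y))

theorem isWitness_iff {e : Entry K} {F : List (Entry K)} {f : Entry K} :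
    isWitness e F f = true ↔ ∀ x ∈ e.1, x ∈ nodesOf F → x ∈ f.1 := by
  simp only [isWitness, List.all_eq_true, Bool.or_eq_true, List.any_eq_true, decide_eq_true_eq,
    Bool.not_eq_true', ← Bool.not_eq_true, exists_eq_right', mem_nodesOf]
  exact forall₂_congr fun x _ => by rw [or_comm, imp_iff_not_or]

variable [CommSemiring K]

/-- The sum, over the rows of the join that are compatible with `r`, of the products of the weights
of their components. -/
def joinWeight : List (Entry K) → Row → K
  | [], _ => 1
  | e :: F, r => (e.2.map fun t =>
      if compat t.1 r then t.2 * joinWeight F (t.1 ++ r) else 0).sum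

theorem joinWeight_eq_length {F : List (Entry K)} (hF : ∀ e ∈ F, ∀ t ∈ e.2, t.2 = 1) (r : Row) :
    joinWeight F r = ((joinRows F r).length : K) := by
  induction F generalizing r with
  | nil => simp [joinWeight, joinRows]
  | cons e F ih =>
    rw [joinWeight, joinRows, List.length_flatMap, Nat.cast_list_sum, List.map_map]
    refine congrArg List.sum (List.map_congr_left fun t ht => ?_)
    rw [hF e (List.mem_cons_self ..) t ht, one_mul,
      ih fun e' he' => hF e' (List.mem_cons_of_mem _ he')]
    simp only [Function.comp_apply]
    split <;> simp

/-- The weight of a join only depends on the part of `r` that concerns its variables. -/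
theorem joinWeight_congr {F : List (Entry K)} (hF : WellFormed F) {r s : Row}
    (h : ∀ x ∈ nodesOf F, ∀ c, (x, c) ∈ r ↔ (x, c) ∈ s) :
    joinWeight F r = joinWeight F s := by
  induction F generalizing r s with
  | nil => rfl
  | cons e F ih =>
    refine congrArg List.sum (List.map_congr_left fun t ht => ?_)
    have hk := (hF e (List.mem_cons_self ..) t ht).1
    have h1 : compat t.1 r = compat t.1 s := by
      rw [Bool.eq_iff_iff, compat_iff, compat_iff]
      have : ∀ x c, (x, c) ∈ t.1 → x ∈ nodesOf (e :: F) := fun x c hc =>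
        unionOf_cons.2 (.inl (hk ▸ ⟨c, hc⟩))
      grind
    have h2 : joinWeight F (t.1 ++ r) = joinWeight F (t.1 ++ s) := by
      refine ih (fun e' he' => hF e' (List.mem_cons_of_mem _ he')) fun x hx c => ?_
      rw [List.mem_append, List.mem_append, h x (unionOf_cons.2 (.inr hx)) c]
    rw [h1, h2]

theorem sum_map_sum_comm {α β : Type} (l : List α) (m : List β) (f : α → β → K) :
    (l.map fun a => (m.map fun b => f a b).sum).sum
      = (m.map fun b => (l.map fun a => f a b).sum).sum := by
  induction l with
  | nil => simp
  | cons a l ih => simp [ih, List.sum_map_add]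

theorem joinWeight_swap {a b : Entry K} {F : List (Entry K)} (hF : WellFormed F) (r : Row) :
    joinWeight (a :: b :: F) r = joinWeight (b :: a :: F) r := by
  have key : ∀ a b : Entry K, joinWeight (a :: b :: F) r
      = (a.2.map fun t => (b.2.map fun s =>
        if compat t.1 r ∧ compat s.1 r ∧ compat s.1 t.1 then
          t.2 * (s.2 * joinWeight F (s.1 ++ (t.1 ++ r))) else 0).sum).sum := by
    intro a b
    refine congrArg List.sum (List.map_congr_left fun t ht => ?_)
    split
    · rename_i h
      rw [joinWeight, ← List.sum_map_mul_left]
      refine congrArg List.sum (List.map_congr_left fun s hs => ?_)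
      by_cases h1 : compat s.1 r <;> by_cases h2 : compat s.1 t.1 <;>
        simp [h, h1, h2, compat_append_right]
    · rename_i h
      simp [h]
  rw [key, key, sum_map_sum_comm]
  refine congrArg List.sum (List.map_congr_left fun s hs => ?_)
  refine congrArg List.sum (List.map_congr_left fun t ht => ?_)
  have h1 : joinWeight F (s.1 ++ (t.1 ++ r)) = joinWeight F (t.1 ++ (s.1 ++ r)) :=
    joinWeight_congr hF fun x _ c => by simp only [List.mem_append]; tauto
  rw [h1]
  refine if_congr ?_ (by ring) rfl
  rw [compat_comm (r := s.1) (s := t.1)]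
  tauto

theorem joinWeight_perm {F G : List (Entry K)} (hF : WellFormed F) (h : F.Perm G) (r : Row) :
    joinWeight F r = joinWeight G r := by
  induction h generalizing r with
  | nil => rfl
  | cons e _ ih =>
    refine congrArg List.sum (List.map_congr_left fun t ht => ?_)
    rw [ih fun e' he' => hF e' (List.mem_cons_of_mem _ he')]
  | swap a b F =>
    exact joinWeight_swap
      (fun e he => hF e (List.mem_cons_of_mem _ (List.mem_cons_of_mem _ he))) r
  | trans h1 _ ih1 ih2 => rw [ih1 hF, ih2 (hF.perm h1)]

/-! ### Counting the rows of an acyclic join by removing ears -/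

/-- The total weight of the rows of `e` that are compatible with `r`. -/
def message (e : Entry K) (r : Row) : K := ((e.2.filter fun s => compat s.1 r).map fun s => s.2).sum

/-- Multiply the weights of the rows of `f` by the weights of their extensions in `e`. -/
def absorbInto (e f : Entry K) : Entry K := (f.1, f.2.map fun t => (t.1, t.2 * message e t.1))

/-- An ear `e` with witness `f` can be removed if `f` absorbs it: a row of `e` that is compatible
with a row of `f` is compatible with all rows of the join that contain the latter. -/
theorem joinWeight_absorb {e f : Entry K} {F : List (Entry K)} (hF : WellFormed (e :: f :: F))
    (h : ∀ x ∈ e.1, x ∈ nodesOf (f :: F) → x ∈ f.1) :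
    joinWeight (e :: f :: F) [] = joinWeight (absorbInto e f :: F) [] := by
  have hF' : WellFormed F := fun e' he' =>
    hF e' (List.mem_cons_of_mem _ (List.mem_cons_of_mem _ he'))
  rw [joinWeight_swap hF']
  simp only [joinWeight, absorbInto, List.map_map]
  refine congrArg List.sum (List.map_congr_left fun t ht => ?_)
  simp only [Function.comp_apply, List.append_nil, mul_assoc]
  congr 2
  have htk := (hF f (List.mem_cons_of_mem _ (List.mem_cons_self ..)) t ht).1
  rw [message, ← List.sum_map_mul_right]
  have : ∀ (l : List (Row × K)), (∀ s ∈ l, s ∈ e.2) →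
      (l.map fun s => if compat s.1 t.1 then s.2 * joinWeight F (s.1 ++ t.1) else 0).sum
      = ((l.filter fun s => compat s.1 t.1).map fun s => s.2 * joinWeight F t.1).sum := by
    intro l hl
    induction l with
    | nil => rfl
    | cons s l ih =>
      have ih := ih fun u hu => hl u (List.mem_cons_of_mem _ hu)
      by_cases hc : compat s.1 t.1
      · have hsk := (hF e (List.mem_cons_self ..) s (hl s (List.mem_cons_self ..))).1
        -- a value in `s` of a variable of `F` is also a value in `t`
        have : joinWeight F (s.1 ++ t.1) = joinWeight F t.1 := by
          refine joinWeight_congr hF' fun x hx c => ?_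
          rw [List.mem_append, or_iff_right_of_imp]
          intro hs
          have hxe : x ∈ edgeOf e := hsk ▸ ⟨c, hs⟩
          have hxf : x ∈ edgeOf f := h x hxe (unionOf_cons.2 (.inr hx))
          rw [← htk] at hxf
          obtain ⟨d, hd⟩ := hxf
          rwa [compat_iff.1 hc x c d hs hd]
        simp [hc, ih, this]
      · simp [hc, ih]
  rw [this _ fun s hs => hs]

/-- One step of the search in `F` for a witness of `e`. The state consists of a flag, saying whether
a witness has been found, and of the relations met so far. -/
def absorbStep (e : Entry K) (F : List (Entry K)) (s : Bool × List (Entry K)) (f : Entry K) :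
    Bool × List (Entry K) :=
  if s.1 then (true, f :: s.2)
  else if isWitness e F f then (true, absorbInto e f :: s.2) else (false, f :: s.2)

/-- Try to remove `e`, letting a member of `F` absorb it; the flag says whether this succeeds. -/
def absorb (e : Entry K) (F : List (Entry K)) : Bool × List (Entry K) :=
  F.foldl (absorbStep e F) (false, [])

theorem foldl_absorbStep_true (e : Entry K) (F l acc : List (Entry K)) :
    l.foldl (absorbStep e F) (true, acc) = (true, l.reverse ++ acc) := by
  induction l generalizing acc with
  | nil => rfl
  | cons f l ih => simp [absorbStep, ih]

theorem foldl_absorbStep_false (e : Entry K) (F l acc : List (Entry K)) :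
    (∃ f m, l.Perm (f :: m) ∧ isWitness e F f = true ∧
      ∃ G, l.foldl (absorbStep e F) (false, acc) = (true, G) ∧
        G.Perm (absorbInto e f :: (m ++ acc))) ∨
    ((l.foldl (absorbStep e F) (false, acc)).1 = false ∧ ∀ f ∈ l, isWitness e F f = false) := by
  induction l generalizing acc with
  | nil => exact .inr ⟨rfl, by simp⟩
  | cons f l ih =>
    by_cases hw : isWitness e F f
    · refine .inl ⟨f, l, .refl _, hw, l.reverse ++ absorbInto e f :: acc, ?_, ?_⟩
      · rw [List.foldl_cons, absorbStep]
        simp only [Bool.false_eq_true, if_false, hw, if_true]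
        exact foldl_absorbStep_true e F l _
      · exact List.perm_middle.trans ((List.reverse_perm l).append_right acc |>.cons _)
    · have hs : (f :: l).foldl (absorbStep e F) (false, acc)
          = l.foldl (absorbStep e F) (false, f :: acc) := by
        simp [absorbStep, hw]
      rw [hs]
      rcases ih (f :: acc) with ⟨g, m, hp, hg, G, hG, hG'⟩ | ⟨h1, h2⟩
      · refine .inl ⟨g, f :: m, (hp.cons f).trans (.swap ..), hg, G, hG, hG'.trans ?_⟩
        exact List.perm_middle.cons _
      · refine .inr ⟨h1, fun g hg => ?_⟩
        rcases List.mem_cons.1 hg with rfl | hg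
        · simpa using hw
        · exact h2 g hg

theorem absorb_spec (e : Entry K) (F : List (Entry K)) :
    ((absorb e F).1 = true ∧ ∃ f m, F.Perm (f :: m) ∧ isWitness e F f = true ∧
      (absorb e F).2.Perm (absorbInto e f :: m)) ∨
    ((absorb e F).1 = false ∧ ∀ f ∈ F, isWitness e F f = false) := by
  rcases foldl_absorbStep_false e F F [] with ⟨f, m, h1, h2, G, h3, h4⟩ | h
  · refine .inl ⟨congrArg Prod.fst h3, f, m, h1, h2, ?_⟩
    have : (absorb e F).2 = G := congrArg Prod.snd h3
    rw [this]
    simpa using h4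
  · exact .inr h

/-- Remove the first relation if it is an ear, and otherwise move it to the end. -/
def earStep (F : List (Entry K)) : List (Entry K) :=
  match F with
  | [] => []
  | e :: F => if (absorb e F).1 then (absorb e F).2 else F ++ [e]

theorem earStep_cases (e : Entry K) (F : List (Entry K)) :
    (∃ f m, F.Perm (f :: m) ∧ (∀ x ∈ e.1, x ∈ nodesOf F → x ∈ f.1) ∧
      (earStep (e :: F)).Perm (absorbInto e f :: m)) ∨
    (earStep (e :: F) = F ++ [e] ∧ ¬ IsEar (edgeOf e) (F.map edgeOf)) := by
  rcases absorb_spec e F with ⟨h, f, m, h1, h2, h3⟩ | ⟨h, h1⟩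
  · refine .inl ⟨f, m, h1, isWitness_iff.1 h2, ?_⟩
    simpa [earStep, h] using h3
  · refine .inr ⟨by simp [earStep, h], ?_⟩
    rintro ⟨g, hg, H⟩
    obtain ⟨f, hf, rfl⟩ := List.mem_map.1 hg
    have := h1 f hf
    rw [isWitness_iff.2 fun x hx hx' => H x hx hx'] at this
    exact absurd this (by simp)

theorem length_earStep_le (F : List (Entry K)) : (earStep F).length ≤ F.length := by
  cases F with
  | nil => rfl
  | cons e F =>
    rcases earStep_cases e F with ⟨f, m, h1, -, h3⟩ | ⟨h, -⟩
    · have := h1.length_eq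
      have := h3.length_eq
      simp only [List.length_cons] at *
      omega
    · simp [h]

theorem earStep_ne_nil {F : List (Entry K)} (hF : F ≠ []) : earStep F ≠ [] := by
  cases F with
  | nil => exact hF
  | cons e F =>
    rcases earStep_cases e F with ⟨f, m, -, -, h3⟩ | ⟨h, -⟩
    · intro h
      rw [h] at h3
      simpa using h3.length_eq
    · simp [h]

/-- A list of relations whose join can be counted by removing ears. -/
structure IsAcyclicJoin (F : List (Entry K)) : Prop where
  wellFormed : WellFormed F
  acyclic : AcyclicList (F.map edgeOf)

theorem earStep_spec {F : List (Entry K)} (hF : IsAcyclicJoin F) :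
    IsAcyclicJoin (earStep F) ∧ joinWeight (earStep F) [] = joinWeight F [] := by
  cases F with
  | nil => exact ⟨hF, rfl⟩
  | cons e F =>
    rcases earStep_cases e F with ⟨f, m, h1, h2, h3⟩ | ⟨h, -⟩
    · have hp : (e :: F).Perm (e :: f :: m) := h1.cons e
      have hw : WellFormed (e :: f :: m) := hF.wellFormed.perm hp
      have hw' : WellFormed (absorbInto e f :: m) := by
        intro g hg t ht
        rcases List.mem_cons.1 hg with rfl | hg
        · obtain ⟨s, hs, rfl⟩ := List.mem_map.1 ht
          exact hw f (by simp) s hs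
        · exact hw g (by simp [hg]) t ht
      have hn : nodesOf F = nodesOf (f :: m) := unionOf_perm (h1.map _)
      refine ⟨⟨hw'.perm h3.symm, ?_⟩, ?_⟩
      · refine AcyclicList.perm ?_ (h3.map edgeOf).symm
        have : AcyclicList (edgeOf e :: (f :: m).map edgeOf) := hF.acyclic.perm (hp.map edgeOf)
        refine this.of_cons ⟨edgeOf f, List.mem_cons_self .., fun x hx hx' => h2 x hx ?_⟩
        rwa [hn]
      · rw [joinWeight_perm (hw'.perm h3.symm) h3, joinWeight_perm hF.wellFormed hp,
          joinWeight_absorb hw fun x hx hx' => h2 x hx (hn ▸ hx')]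
    · rw [h]
      have hp : (e :: F).Perm (F ++ [e]) := (List.perm_append_singleton e F).symm
      exact ⟨⟨hF.wellFormed.perm hp, hF.acyclic.perm (hp.map _)⟩,
        (joinWeight_perm hF.wellFormed hp _).symm⟩

theorem earStep_iterate_spec {F : List (Entry K)} (hF : IsAcyclicJoin F) (k : ℕ) :
    IsAcyclicJoin (earStep^[k] F) ∧ joinWeight (earStep^[k] F) [] = joinWeight F [] := by
  induction k with
  | zero => exact ⟨hF, rfl⟩
  | succ k ih =>
    rw [Function.iterate_succ_apply']
    obtain ⟨h1, h2⟩ := earStep_spec ih.1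
    exact ⟨h1, h2.trans ih.2⟩

theorem length_earStep_iterate_le (F : List (Entry K)) (k : ℕ) :
    (earStep^[k] F).length ≤ F.length := by
  induction k with
  | zero => exact le_rfl
  | succ k ih =>
    rw [Function.iterate_succ_apply']
    exact (length_earStep_le _).trans ih

theorem earStep_iterate_ne_nil {F : List (Entry K)} (hF : F ≠ []) (k : ℕ) :
    earStep^[k] F ≠ [] := by
  induction k with
  | zero => exact hF
  | succ k ih =>
    rw [Function.iterate_succ_apply']
    exact earStep_ne_nil ih

/-- The rotations bring every ear to the front, unless another ear is removed before. -/
theorem exists_length_lt {s t : List (Entry K)} {e : Entry K}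
    (he : IsEar (edgeOf e) ((s ++ t).map edgeOf)) :
    ∃ k ≤ s.length + 1, (earStep^[k] (s ++ e :: t)).length < (s ++ e :: t).length := by
  induction s generalizing t with
  | nil =>
    refine ⟨1, by simp, ?_⟩
    rcases earStep_cases e t with ⟨f, m, h1, -, h3⟩ | ⟨-, h⟩
    · have := h1.length_eq
      have := h3.length_eq
      simp only [Function.iterate_one, List.nil_append, List.length_cons] at *
      omega
    · exact absurd he h
  | cons a s ih =>
    rcases earStep_cases a (s ++ e :: t) with ⟨f, m, h1, -, h3⟩ | ⟨h, -⟩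
    · refine ⟨1, by simp, ?_⟩
      have := h1.length_eq
      have := h3.length_eq
      simp only [Function.iterate_one, List.cons_append, List.length_cons] at *
      omega
    · obtain ⟨k, hk, hlt⟩ := ih (t := t ++ [a]) (he.perm (List.Perm.map _ (by
        rw [← List.append_assoc]
        exact (List.perm_append_singleton a (s ++ t)).symm)))
      refine ⟨k + 1, by simp only [List.length_cons]; omega, ?_⟩
      rw [Function.iterate_succ_apply, List.cons_append, h]
      simp only [List.append_assoc, List.cons_append, List.length_append, List.length_cons,
        List.length_nil] at hlt ⊢
      omega

theorem length_earStep_iterate {F : List (Entry K)} (hF : IsAcyclicJoin F) :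
    (earStep^[F.length * F.length] F).length ≤ 1 := by
  suffices ∃ k ≤ F.length * F.length, (earStep^[k] F).length ≤ 1 by
    obtain ⟨k, hk, h⟩ := this
    rw [← Nat.sub_add_cancel hk, Function.iterate_add_apply]
    exact (length_earStep_iterate_le _ _).trans h
  induction hn : F.length using Nat.strong_induction_on generalizing F with
  | _ n ih =>
  subst hn
  by_cases h2 : F.length ≤ 1
  · exact ⟨0, by simp, h2⟩
  · obtain ⟨e, m, hp, he⟩ := hF.acyclic.exists_isEar (by simp; omega)
    obtain ⟨g, hg, rfl⟩ := List.mem_map.1 (hp.mem_iff.2 (List.mem_cons_self ..))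
    obtain ⟨s, t, rfl⟩ := List.append_of_mem hg
    have hp' : ((s ++ t).map edgeOf).Perm m := by
      refine List.Perm.cons_inv (a := edgeOf g) (.trans ?_ hp)
      exact (List.perm_middle.map edgeOf).symm
    obtain ⟨k, hk, hlt⟩ := exists_length_lt (he.perm hp'.symm)
    obtain ⟨j, hj, hj'⟩ := ih _ hlt (earStep_iterate_spec hF k).1 rfl
    refine ⟨j + k, ?_, by rwa [Function.iterate_add_apply]⟩
    have h3 : s.length + 1 ≤ (s ++ g :: t).length := by simp
    generalize (earStep^[k] (s ++ g :: t)).length = a at *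
    generalize (s ++ g :: t).length = n at *
    nlinarith

/-- Remove ears until a single relation is left. The list that is folded only serves to make enough
steps. -/
def removeEars (F : List (Entry K)) : List (Entry K) :=
  (F.flatMap fun _ => F).foldl (fun G _ => earStep G) F

theorem removeEars_eq (F : List (Entry K)) :
    removeEars F = earStep^[F.length * F.length] F := by
  rw [removeEars, List.foldl_const]
  simp

/-- The weight of the join of an acyclic list of relations. -/
def countJoin (F : List (Entry K)) : K :=
  ((removeEars F).flatMap fun e => e.2.map fun t => t.2).sum

theorem countJoin_eq {F : List (Entry K)} (hF : IsAcyclicJoin F) (hne : F ≠ []) :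
    countJoin F = joinWeight F [] := by
  rw [countJoin, removeEars_eq, ← (earStep_iterate_spec hF (F.length * F.length)).2]
  have h1 := length_earStep_iterate hF
  have h2 := earStep_iterate_ne_nil hne (F.length * F.length)
  match earStep^[F.length * F.length] F, h1, h2 with
  | [e], _, _ => simp [joinWeight, compat]

end Join

/-! ### Removing ears takes polynomial time -/

/-- The total weight of the rows of a relation. -/
def totalWeight (e : Entry Bin) : ℕ := (e.2.map fun t => t.2.val).sum

/-- A bound on all weights that occur while ears are removed. -/
def weightBound (F : List (Entry Bin)) : ℕ := (F.map fun e => totalWeight e + 1).prod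

/-- The size of a list of relations, apart from the weights. -/
def skeletonSize (F : List (Entry Bin)) : ℕ :=
  (F.map fun e => esize e.1 + (e.2.map fun t => esize t.1 + 2).sum + 3).sum

theorem val_sum (l : List Bin) : l.sum.val = (l.map Bin.val).sum := by
  induction l with
  | nil => rfl
  | cons a l ih => simp [ih]

theorem message_val_le (e : Entry Bin) (r : Row) : (message e r).val ≤ totalWeight e := by
  rw [message, val_sum, List.map_map, totalWeight]
  exact (List.Sublist.map _ List.filter_sublist).sum_le_sum (by simp)

theorem totalWeight_absorbInto (e f : Entry Bin) :
    totalWeight (absorbInto e f) ≤ totalWeight f * totalWeight e := by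
  simp only [totalWeight, absorbInto, List.map_map]
  rw [← List.sum_map_mul_right]
  exact List.sum_le_sum fun t _ => Nat.mul_le_mul_left _ (message_val_le e t.1)

theorem weightBound_perm {F G : List (Entry Bin)} (h : F.Perm G) :
    weightBound F = weightBound G := (h.map _).prod_eq

theorem skeletonSize_perm {F G : List (Entry Bin)} (h : F.Perm G) :
    skeletonSize F = skeletonSize G := (h.map _).sum_eq

/-- For sums `a` and `b` of weights, `a * b + 1 ≤ (a + 1) * (b + 1)`: when a relation absorbs
another one, the bound does not increase. -/
theorem weightBound_earStep_le (F : List (Entry Bin)) :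
    weightBound (earStep F) ≤ weightBound F := by
  cases F with
  | nil => exact le_rfl
  | cons e F =>
    rcases earStep_cases e F with ⟨f, m, h1, -, h3⟩ | ⟨h, -⟩
    · rw [weightBound_perm h3, weightBound_perm (h1.cons e)]
      simp only [weightBound, List.map_cons, List.prod_cons, ← mul_assoc]
      refine Nat.mul_le_mul_right _ ?_
      have := totalWeight_absorbInto e f
      nlinarith
    · rw [h, weightBound_perm (List.perm_append_singleton e F)]

theorem skeletonSize_earStep_le (F : List (Entry Bin)) :
    skeletonSize (earStep F) ≤ skeletonSize F := by
  cases F with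
  | nil => exact le_rfl
  | cons e F =>
    rcases earStep_cases e F with ⟨f, m, h1, -, h3⟩ | ⟨h, -⟩
    · rw [skeletonSize_perm h3, skeletonSize_perm (h1.cons e)]
      simp [skeletonSize, absorbInto, Function.comp_def]
    · rw [h, skeletonSize_perm (List.perm_append_singleton e F)]

theorem totalWeight_lt (l : List (Row × Bin)) :
    (l.map fun t => t.2.val).sum + 1 ≤ 2 ^ esize l := by
  induction l with
  | nil => simp
  | cons t l ih =>
    have h1 : t.2.val + 1 ≤ 2 ^ esize t.2 :=
      (Nat.lt_size_self _).trans_le (Nat.pow_le_pow_right two_pos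
        (Nat.le_of_succ_le (Bin.size_lt_esize _)))
    have h2 := Nat.mul_le_mul h1 ih
    rw [← pow_add] at h2
    have h3 : 2 ^ (esize t.2 + esize l) ≤ 2 ^ esize (t :: l) := by
      refine Nat.pow_le_pow_right two_pos ?_
      have : esize t = esize t.1 + esize t.2 + 1 := rfl
      rw [esize_cons]
      omega
    refine le_trans ?_ (h2.trans h3)
    simp only [List.map_cons, List.sum_cons]
    nlinarith [Nat.zero_le (t.2.val * (l.map fun t => t.2.val).sum)]

theorem weightBound_le (F : List (Entry Bin)) : weightBound F ≤ 2 ^ esize F := by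
  induction F with
  | nil => simp [weightBound]
  | cons e F ih =>
    have h1 : totalWeight e + 1 ≤ 2 ^ esize e.2 := totalWeight_lt e.2
    have h2 := Nat.mul_le_mul h1 ih
    rw [← pow_add] at h2
    refine (h2.trans (Nat.pow_le_pow_right two_pos ?_) :)
    have : esize e = esize e.1 + esize e.2 + 1 := rfl
    rw [esize_cons]
    omega

theorem skeletonSize_le (F : List (Entry Bin)) : skeletonSize F ≤ esize F := by
  have key : ∀ l : List (Row × Bin), (l.map fun t => esize t.1 + 2).sum + 1 ≤ esize l := by
    intro l
    induction l with
    | nil => simp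
    | cons t l ih =>
      have : esize t = esize t.1 + esize t.2 + 1 := rfl
      have := esize_pos t.2
      simp only [List.map_cons, List.sum_cons, esize_cons]
      omega
  induction F with
  | nil => simp [skeletonSize]
  | cons e F ih =>
    have : esize e = esize e.1 + esize e.2 + 1 := rfl
    have := key e.2
    simp only [skeletonSize, List.map_cons, List.sum_cons, esize_cons] at ih ⊢
    omega

theorem esize_le_skeletonSize {F : List (Entry Bin)} {C : ℕ}
    (h : ∀ e ∈ F, ∀ t ∈ e.2, esize t.2 ≤ C) : esize F ≤ 1 + skeletonSize F * (C + 1) := by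
  have key : ∀ l : List (Row × Bin), (∀ t ∈ l, esize t.2 ≤ C) →
      esize l ≤ 1 + (l.map fun t => esize t.1 + 2).sum * (C + 1) := by
    intro l hl
    induction l with
    | nil => simp
    | cons t l ih =>
      have h1 : esize t = esize t.1 + esize t.2 + 1 := rfl
      have h2 := hl t (List.mem_cons_self ..)
      have h3 := ih fun s hs => hl s (List.mem_cons_of_mem _ hs)
      simp only [List.map_cons, List.sum_cons, esize_cons]
      nlinarith
  induction F with
  | nil => simp
  | cons e F ih =>
    have h1 : esize e = esize e.1 + esize e.2 + 1 := rfl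
    have h2 := key e.2 (h e (List.mem_cons_self ..))
    have h3 := ih fun e' he' => h e' (List.mem_cons_of_mem _ he')
    simp only [skeletonSize, List.map_cons, List.sum_cons, esize_cons] at h3 ⊢
    nlinarith

theorem val_le_weightBound {F : List (Entry Bin)} {e : Entry Bin} (he : e ∈ F) {t : Row × Bin}
    (ht : t ∈ e.2) : t.2.val ≤ weightBound F := by
  have h1 : t.2.val ≤ totalWeight e := 
    List.le_sum_of_mem (List.mem_map_of_mem (f := fun t : Row × Bin => t.2.val) ht)
  have h2 : totalWeight e + 1 ≤ weightBound F := by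
    induction F with
    | nil => simp at he
    | cons g F ih =>
      have hpos : 1 ≤ weightBound F := by
        rw [weightBound]
        exact List.one_le_prod fun x hx => by
          obtain ⟨e', -, rfl⟩ := List.mem_map.1 hx
          omega
      have : weightBound (g :: F) = (totalWeight g + 1) * weightBound F := rfl
      rw [this]
      rcases List.mem_cons.1 he with rfl | he
      · exact Nat.le_mul_of_pos_right _ hpos
      · exact (ih he).trans (Nat.le_mul_of_pos_left _ (Nat.succ_pos _))
  omega

/-- All intermediate results of the removal of ears have polynomial size. The relations only lose
members, and the weights do not exceed `weightBound F`, so that they have at most as many digits as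
the encoding of `F` has nodes, plus one. -/
theorem esize_earStep_iterate_le (F : List (Entry Bin)) (k : ℕ) :
    esize (earStep^[k] F) ≤ 1 + esize F * (4 * esize F + 6) := by
  have h1 : weightBound (earStep^[k] F) ≤ 2 ^ esize F := by
    refine le_trans ?_ (weightBound_le F)
    induction k with
    | zero => exact le_rfl
    | succ k ih =>
      rw [Function.iterate_succ_apply']
      exact (weightBound_earStep_le _).trans ih
  have h2 : skeletonSize (earStep^[k] F) ≤ esize F := by
    refine le_trans ?_ (skeletonSize_le F)
    clear h1
    induction k with
    | zero => exact le_rfl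
    | succ k ih =>
      rw [Function.iterate_succ_apply']
      exact (skeletonSize_earStep_le _).trans ih
  refine (esize_le_skeletonSize (C := 4 * esize F + 5) fun e he t ht => ?_).trans
    (Nat.add_le_add_left (Nat.mul_le_mul_right _ h2) 1)
  have h3 := (val_le_weightBound he ht).trans h1
  have h4 : t.2.val.size ≤ esize F + 1 := by
    rw [Nat.size_le, pow_succ]
    have : 0 < 2 ^ esize F := by positivity
    omega
  have := Bin.esize_le t.2
  omega

section

variable {α : Type} [Enc α]

@[fun_prop] theorem PT.compat {f g : α → Row} (hf : PT f) (hg : PT g) :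
    PT (fun a => compat (f a) (g a)) := by
  unfold CountCQ.compat; fun_prop

@[fun_prop] theorem PT.message {f : α → Entry Bin} {g : α → Row} (hf : PT f) (hg : PT g) :
    PT (fun a => message (f a) (g a)) := by
  unfold CountCQ.message; fun_prop

@[fun_prop] theorem PT.absorbInto {f g : α → Entry Bin} (hf : PT f) (hg : PT g) :
    PT (fun a => absorbInto (f a) (g a)) := by
  unfold CountCQ.absorbInto; fun_prop

@[fun_prop] theorem PT.isWitness {f g : α → Entry Bin} {F : α → List (Entry Bin)} (hf : PT f)
    (hF : PT F) (hg : PT g) : PT (fun a => isWitness (f a) (F a) (g a)) := by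
  unfold CountCQ.isWitness; fun_prop

@[fun_prop] theorem PT.absorb {f : α → Entry Bin} {F : α → List (Entry Bin)} (hf : PT f)
    (hF : PT F) : PT (fun a => absorb (f a) (F a)) := by
  have h : PT (fun p : Entry Bin × List (Entry Bin) => CountCQ.absorb p.1 p.2) := by
    obtain ⟨q, hq⟩ := (PT.absorbInto (PT.fst' (α := Entry Bin) (β := Entry Bin)) PT.snd').size_le
    refine PT.foldl_of_add (l := fun p : Entry Bin × List (Entry Bin) => p.2)
      (b := fun _ => (false, [])) (f := fun p => absorbStep p.1 p.2) (by fun_prop) (by fun_prop)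
      (by unfold absorbStep; fun_prop) (.X + q + 3) fun p s f => ?_
    obtain ⟨b, G⟩ := s
    have h1 : ∀ b : Bool, 1 ≤ esize b ∧ esize b ≤ 3 := by
      intro b; cases b <;> simp [esize, enc, Data.ofBool, Data.size]
    have h2 := h1 b
    have h3 := h1 (absorbStep p.1 p.2 (b, G) f).1
    have h4 : esize (absorbStep p.1 p.2 (b, G) f).2
        ≤ esize G + (esize p + esize f + q.eval (esize p + esize f)) + 1 := by
      have h5 := hq (p.1, f)
      have h6 : esize p = esize p.1 + esize p.2 + 1 := rfl
      have h7 : q.eval (esize (p.1, f)) ≤ q.eval (esize p + esize f) := by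
        refine eval_mono q ?_
        rw [esize_mk]
        have := esize_pos p.2
        omega
      unfold absorbStep
      split
      · simp only [esize_cons]
        omega
      · split
        · simp only [esize_cons]
          simp only at h5
          omega
        · simp only [esize_cons]
          omega
    have h5 : esize (absorbStep p.1 p.2 (b, G) f)
      = esize (absorbStep p.1 p.2 (b, G) f).1 + esize (absorbStep p.1 p.2 (b, G) f).2 + 1 := rfl
    simp only [esize_mk, Polynomial.eval_add, Polynomial.eval_X, Polynomial.eval_ofNat]
    omega
  exact h.comp (hf.mk hF)

@[fun_prop] theorem PT.earStep {F : α → List (Entry Bin)} (hF : PT F) :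
    PT (fun a => earStep (F a)) :=
  (PT.casesList (f := fun _ => []) (g := fun _ e F =>
    if (CountCQ.absorb e F).1 then (CountCQ.absorb e F).2 else F ++ [e]) hF (by fun_prop)
    (by fun_prop)).congr fun a => by cases F a <;> rfl

@[fun_prop] theorem PT.removeEars {F : α → List (Entry Bin)} (hF : PT F) :
    PT (fun a => removeEars (F a)) := by
  have h : PT (fun F : List (Entry Bin) => CountCQ.removeEars F) := by
    refine PT.foldl (l := fun F : List (Entry Bin) => F.flatMap fun _ => F) (b := fun F => F)
      (f := fun _ G _ => CountCQ.earStep G) (by fun_prop) (by fun_prop) (by fun_prop)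
      (B := 1 + .X * (4 * .X + 6)) fun F k => ?_
    rw [List.foldl_const]
    simpa using esize_earStep_iterate_le F _
  exact h.comp hF

@[fun_prop] theorem PT.countJoin {F : α → List (Entry Bin)} (hF : PT F) :
    PT (fun a => countJoin (F a)) := by
  unfold CountCQ.countJoin; fun_prop

end

/-! ### The algorithm -/

/-- Is the term a constant? -/
def Term.isConst : Term → Bool
  | var _ => false
  | const _ => true

/-- The name of a term. -/
def Term.name : Term → ℕ
  | var x => x
  | const c => c

/-- The variables of an atom whose terms are matched with values, together with their values. -/
def bindings (z : List (Term × ℕ)) : Row :=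
  (z.filter fun p => !p.1.isConst).map fun p => (p.1.name, p.2)

/-- The row that maps the terms `args` to the values `u`, if there is one. -/
def matchRow (args : List Term) (u : List ℕ) : List Row :=
  if ((args.zip u).all fun p => !p.1.isConst || decide (p.1.name = p.2)) &&
    compat (bindings (args.zip u)) (bindings (args.zip u)) then [bindings (args.zip u)] else []

/-- The substitutions for the variables of `a` that map `a` into `D`. -/
def atomRows (D : Database) (a : Atom ℕ) : List Row :=
  D.rels.flatMap fun R =>
    if decide (R.sym = a.rel) then R.tuples.flatMap fun u => matchRow a.args u else []

/-- Do all variables in `h` occur in `a`? -/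
def coveredBy (h : List ℕ) (a : Atom ℕ) : Bool :=
  h.all fun x => a.args.any fun t => !t.isConst && decide (t.name = x)

/-- Do all variables of `a` occur in `h`? -/
def isInside (a : Atom ℕ) (h : List ℕ) : Bool :=
  a.args.all fun t => t.isConst || h.any fun x => decide (x = t.name)

/-- The restriction of a row to the variables in `h`. -/
def restrictRow (h : List ℕ) (r : Row) : Row := r.filter fun p => h.any fun x => decide (x = p.1)

/-- The restrictions to `h` of the rows of the views that cover `h`. -/
def viewRows (V : List (Atom ℕ)) (D : Database) (h : List ℕ) : List Row :=
  V.flatMap fun w => if coveredBy h w then (atomRows D w).map fun r => restrictRow h r else []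

/-- Does the row `r` satisfy those atoms of `Q` all of whose variables are in `h`? -/
def satisfiesInside (Q : Query) (D : Database) (h : List ℕ) (r : Row) : Bool :=
  Q.atoms.all fun q => !isInside q h || (atomRows D q).any fun s => compat r s

/-- The relation over a hyperedge of the decomposition: the rows of the views that cover it,
filtered by the atoms of the query. -/
def baseEntry (Q : Query) (V : List (Atom ℕ)) (D : Database) (h : List ℕ) : Entry Bin :=
  (h, ((viewRows V D h).filter fun r => satisfiesInside Q D h r).map fun r => (r, 1))

/-- The relations over the hyperedges of the decomposition. -/
def baseJoin (Q : Query) (V : List (Atom ℕ)) (D : Database) (L : HypergraphList) :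
    List (Entry Bin) := L.edges.map fun h => baseEntry Q V D h

/-- Does the row `r` over `h` extend to a row of the join of `F`? -/
def isExtendible (F : List (Entry Bin)) (h : List ℕ) (r : Row) : Bool :=
  !decide (countJoin ((h, [(r, 1)]) :: F) = 0)

/-- The variables in `h` that are not quantified. -/
def freePart (Q : Query) (h : List ℕ) : List ℕ :=
  h.filter fun x => !(Q.quantified.any fun y => decide (x = y))

/-- Drop the rows that are compatible with an earlier one; for rows over the same variables, these
are the repetitions. -/
def dedupRows (l : List Row) : List Row :=
  l.foldl (fun acc r => if acc.any fun s => compat r s then acc else r :: acc) []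

/-- The restrictions to the free variables of those rows of `e` that extend to the join of `F`. -/
def freeEntry (Q : Query) (F : List (Entry Bin)) (e : Entry Bin) : Entry Bin :=
  (freePart Q e.1, (dedupRows ((e.2.filter fun t => isExtendible F e.1 t.1).map
    fun t => restrictRow (freePart Q e.1) t.1)).map fun r => (r, 1))

/-- The relations over the free variables whose join is the set of answers. -/
def freeJoin (Q : Query) (F : List (Entry Bin)) : List (Entry Bin) :=
  F.map fun e => freeEntry Q F e

/-- The number of answers. -/
def countAnswers (Q : Query) (V : List (Atom ℕ)) (D : Database) (L : HypergraphList) : Bin :=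
  countJoin (freeJoin Q (baseJoin Q V D L))

/-! ### The algorithm takes polynomial time -/

instance : Enc Term := ⟨Term.encode⟩
instance : Enc (Atom ℕ) := ⟨Atom.encode⟩
instance : Enc Query := ⟨Query.encode⟩
instance : Enc RelInstance := ⟨RelInstance.encode⟩
instance : Enc Database := ⟨Database.encode⟩
instance : Enc HypergraphList := ⟨HypergraphList.encode⟩

section

variable {α : Type} [Enc α]

@[fun_prop] theorem PT.isConst {f : α → Term} (hf : PT f) : PT (fun a => (f a).isConst) :=
  PT.comp (g := Term.isConst) (.of_step .left fun t => by cases t <;> exact .left _) hf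

@[fun_prop] theorem PT.name {f : α → Term} (hf : PT f) : PT (fun a => (f a).name) :=
  PT.comp (g := Term.name) (.of_step .right fun t => by cases t <;> exact .right _) hf

@[fun_prop] theorem PT.rel {f : α → Atom ℕ} (hf : PT f) : PT (fun a => (f a).rel) :=
  PT.comp (g := fun a : Atom ℕ => a.rel) (.of_step .left fun a => .left (enc a)) hf

@[fun_prop] theorem PT.args {f : α → Atom ℕ} (hf : PT f) : PT (fun a => (f a).args) :=
  PT.comp (g := fun a : Atom ℕ => a.args) (.of_step .right fun a => .right (enc a)) hf

@[fun_prop] theorem PT.atoms {f : α → Query} (hf : PT f) : PT (fun a => (f a).atoms) :=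
  PT.comp (g := fun Q : Query => Q.atoms) (.of_step .left fun a => .left (enc a)) hf

@[fun_prop] theorem PT.quantified {f : α → Query} (hf : PT f) : PT (fun a => (f a).quantified) :=
  PT.comp (g := fun Q : Query => Q.quantified) (.of_step .right fun a => .right (enc a)) hf

@[fun_prop] theorem PT.sym {f : α → RelInstance} (hf : PT f) : PT (fun a => (f a).sym) :=
  PT.comp (g := fun R : RelInstance => R.sym) (.of_step .left fun a => .left (enc a)) hf

@[fun_prop] theorem PT.tuples {f : α → RelInstance} (hf : PT f) : PT (fun a => (f a).tuples) := by
  refine PT.comp (g := fun R : RelInstance => R.tuples)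
    ⟨.seq .right .right, 2 * .X + 1, fun R => ⟨_, ?_, .seq (.right (enc R)) (.right _)⟩⟩ hf
  have : (enc R).right.size ≤ (enc R).size := Data.size_right_le _
  simp only [Polynomial.eval_add, Polynomial.eval_mul, Polynomial.eval_X, Polynomial.eval_ofNat,
    Polynomial.eval_one, esize]
  omega

@[fun_prop] theorem PT.rels {f : α → Database} (hf : PT f) : PT (fun a => (f a).rels) :=
  PT.comp (g := fun D : Database => D.rels) (.of_step .right fun a => .right (enc a)) hf

@[fun_prop] theorem PT.edges {f : α → HypergraphList} (hf : PT f) : PT (fun a => (f a).edges) :=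
  PT.comp (g := fun L : HypergraphList => L.edges) (.of_step .right fun a => .right (enc a)) hf

@[fun_prop] theorem PT.matchRow {f : α → List Term} {g : α → List ℕ} (hf : PT f) (hg : PT g) :
    PT (fun a => matchRow (f a) (g a)) := by
  unfold CountCQ.matchRow bindings; fun_prop

@[fun_prop] theorem PT.atomRows {D : α → Database} {f : α → Atom ℕ} (hD : PT D) (hf : PT f) :
    PT (fun a => atomRows (D a) (f a)) := by
  unfold CountCQ.atomRows; fun_prop

@[fun_prop] theorem PT.coveredBy {f : α → List ℕ} {g : α → Atom ℕ} (hf : PT f) (hg : PT g) :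
    PT (fun a => coveredBy (f a) (g a)) := by
  unfold CountCQ.coveredBy; fun_prop

@[fun_prop] theorem PT.isInside {f : α → Atom ℕ} {g : α → List ℕ} (hf : PT f) (hg : PT g) :
    PT (fun a => isInside (f a) (g a)) := by
  unfold CountCQ.isInside; fun_prop

@[fun_prop] theorem PT.restrictRow {f : α → List ℕ} {g : α → Row} (hf : PT f) (hg : PT g) :
    PT (fun a => restrictRow (f a) (g a)) := by
  unfold CountCQ.restrictRow; fun_prop

@[fun_prop] theorem PT.freePart {Q : α → Query} {g : α → List ℕ} (hQ : PT Q) (hg : PT g) :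
    PT (fun a => freePart (Q a) (g a)) := by
  unfold CountCQ.freePart; fun_prop

@[fun_prop] theorem PT.dedupRows {f : α → List Row} (hf : PT f) :
    PT (fun a => dedupRows (f a)) := by
  refine PT.foldl_of_add (b := fun _ => [])
    (f := fun _ acc r => if acc.any fun s => CountCQ.compat r s then acc else r :: acc) hf
    (by fun_prop) (by fun_prop) (.X + 1) fun a acc r => ?_
  simp only [Polynomial.eval_add, Polynomial.eval_X, Polynomial.eval_one]
  split
  · omega
  · rw [esize_cons]
    omega

@[fun_prop] theorem PT.viewRows {V : α → List (Atom ℕ)} {D : α → Database} {h : α → List ℕ}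
    (hV : PT V) (hD : PT D) (hh : PT h) : PT (fun a => viewRows (V a) (D a) (h a)) := by
  unfold CountCQ.viewRows; fun_prop

@[fun_prop] theorem PT.satisfiesInside {Q : α → Query} {D : α → Database} {h : α → List ℕ}
    {r : α → Row} (hQ : PT Q) (hD : PT D) (hh : PT h) (hr : PT r) :
    PT (fun a => satisfiesInside (Q a) (D a) (h a) (r a)) := by
  unfold CountCQ.satisfiesInside; fun_prop

@[fun_prop] theorem PT.baseJoin {Q : α → Query} {V : α → List (Atom ℕ)} {D : α → Database}
    {L : α → HypergraphList} (hQ : PT Q) (hV : PT V) (hD : PT D) (hL : PT L) :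
    PT (fun a => baseJoin (Q a) (V a) (D a) (L a)) := by
  unfold CountCQ.baseJoin baseEntry; fun_prop

@[fun_prop] theorem PT.isExtendible {F : α → List (Entry Bin)} {h : α → List ℕ} {r : α → Row}
    (hF : PT F) (hh : PT h) (hr : PT r) : PT (fun a => isExtendible (F a) (h a) (r a)) := by
  unfold CountCQ.isExtendible; fun_prop

@[fun_prop] theorem PT.freeJoin {Q : α → Query} {F : α → List (Entry Bin)} (hQ : PT Q)
    (hF : PT F) : PT (fun a => freeJoin (Q a) (F a)) := by
  unfold CountCQ.freeJoin freeEntry; fun_prop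

theorem PT.countAnswers : PT (fun p : Query × List (Atom ℕ) × Database × HypergraphList =>
    countAnswers p.1 p.2.1 p.2.2.1 p.2.2.2) := by
  unfold CountCQ.countAnswers; fun_prop

end

/-- The views are declared in the database, so that their size is polynomial in its size. -/
theorem esize_views_le {V : List (Atom ℕ)} {D : Database} (hV : (V.map Atom.rel).Nodup)
    (hD : ∀ w ∈ V, D.Declares w) : esize V ≤ 1 + D.size * (6 * D.size + 4) := by
  have h1 : V.length ≤ D.rels.length := by
    have : V.map Atom.rel ⊆ D.rels.map RelInstance.sym := by
      intro s hs
      obtain ⟨w, hw, rfl⟩ := List.mem_map.1 hs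
      obtain ⟨R, hR, h, -⟩ := hD w hw
      exact List.mem_map.2 ⟨R, hR, h⟩
    simpa using (hV.subperm this).length_le
  have hDs : D.size = esize D.dom + esize D.rels + 1 := rfl
  have h2 := length_le_esize D.rels
  have hargs : ∀ l : List Term, esize l ≤ 6 * l.length + 1 := by
    intro l
    induction l with
    | nil => simp
    | cons t l ih =>
      have : esize t ≤ 5 := by
        cases t <;> simp [esize, enc, Term.encode, Data.ofBool, Data.size]
      simp only [esize_cons, List.length_cons]
      omega
  have h3 : ∀ w ∈ V, esize w ≤ 6 * D.size + 3 := by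
    intro w hw
    obtain ⟨R, hR, -, h⟩ := hD w hw
    have h4 : esize w = 1 + esize w.args + 1 := rfl
    have h5 : esize R = 1 + ((encodeList id (List.replicate R.arity Data.nil)).size +
      esize R.tuples + 1) + 1 := rfl
    have h6 : ∀ n, n ≤ (encodeList id (List.replicate n Data.nil)).size := by
      intro n
      induction n with
      | zero => simp
      | succ n ih =>
        simp only [List.replicate_succ, encodeList, Data.size]
        omega
    have h7 := h6 R.arity
    have h8 := esize_le_of_mem hR
    have h9 := hargs w.args
    omega
  have key : ∀ l : List (Atom ℕ), (∀ w ∈ l, esize w ≤ 6 * D.size + 3) →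
      esize l ≤ 1 + l.length * (6 * D.size + 4) := by
    intro l hl
    induction l with
    | nil => simp
    | cons w l ih =>
      have := hl w (List.mem_cons_self ..)
      have := ih fun v hv => hl v (List.mem_cons_of_mem _ hv)
      simp only [esize_cons, List.length_cons, Nat.add_mul, one_mul]
      omega
  refine (key V h3).trans (Nat.add_le_add_left (Nat.mul_le_mul_right _ ?_) 1)
  omega

/-! ### Rows of atoms -/

theorem mem_bindings {z : List (Term × ℕ)} {x c : ℕ} :
    (x, c) ∈ bindings z ↔ (Term.var x, c) ∈ z := by
  simp only [bindings, List.mem_map, List.mem_filter, Prod.exists, Prod.mk.injEq]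
  constructor
  · rintro ⟨t, d, ⟨h, ht⟩, rfl, rfl⟩
    cases t with
    | var y => exact h
    | const y => simp [Term.isConst] at ht
  · exact fun h => ⟨.var x, c, ⟨h, rfl⟩, rfl, rfl⟩

theorem map_eval_eq_iff {θ : ℕ → ℕ} {args : List Term} {u : List ℕ}
    (h : u.length = args.length) :
    args.map (Term.eval θ) = u ↔ ∀ p ∈ args.zip u, p.1.eval θ = p.2 := by
  induction args generalizing u with
  | nil => simpa using List.length_eq_zero_iff.1 h
  | cons t l ih =>
    cases u with
    | nil => simp at h
    | cons c u => simp [ih (u := u) (by simpa using h)]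

theorem exists_matchRow {θ : ℕ → ℕ} {args : List Term} {u : List ℕ}
    (h : u.length = args.length) :
    (∃ r ∈ matchRow args u, Extends θ r) ↔ args.map (Term.eval θ) = u := by
  rw [map_eval_eq_iff h]
  have key : (∀ p ∈ args.zip u, p.1.eval θ = p.2) ↔
      ((args.zip u).all fun p => !p.1.isConst || decide (p.1.name = p.2)) = true ∧
        Extends θ (bindings (args.zip u)) := by
    simp only [List.all_eq_true, Prod.forall, Extends, mem_bindings]
    constructor
    · intro H
      refine ⟨fun t c hc => ?_, fun x c hc => H _ _ hc⟩
      have := H t c hc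
      cases t <;> simp_all [Term.isConst, Term.name, Term.eval]
    · rintro ⟨H1, H2⟩ t c hc
      cases t with
      | var x => exact H2 x c hc
      | const d => exact of_decide_eq_true (H1 _ c hc)
  rw [key, matchRow]
  constructor
  · rintro ⟨r, hr, hθ⟩
    split at hr
    · rename_i hc
      rw [Bool.and_eq_true] at hc
      obtain rfl : r = bindings (args.zip u) := by simpa using hr
      exact ⟨hc.1, hθ⟩
    · simp at hr
  · rintro ⟨h1, h2⟩
    refine ⟨bindings (args.zip u), ?_, h2⟩
    rw [if_pos (by rw [Bool.and_eq_true]; exact ⟨h1, compat_of_extends h2 h2⟩)]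
    exact List.mem_singleton_self _

theorem isRowOn_of_mem_matchRow {a : Atom ℕ} {u : List ℕ} (h : u.length = a.args.length)
    {r : Row} (hr : r ∈ matchRow a.args u) : IsRowOn a.vars r := by
  rw [matchRow] at hr
  split at hr
  · rename_i hc
    rw [Bool.and_eq_true] at hc
    obtain rfl : r = bindings (a.args.zip u) := by simpa using hr
    refine ⟨?_, hc.2⟩
    ext x
    simp only [keys, Set.mem_ofPred_eq, mem_bindings, Atom.vars]
    constructor
    · rintro ⟨c, hc⟩
      exact (List.of_mem_zip hc).1
    · intro hx
      obtain ⟨i, hi, hix⟩ := List.mem_iff_getElem.1 hx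
      refine ⟨u[i], List.mem_iff_getElem.2 ⟨i, by simp; omega, ?_⟩⟩
      simp [hix]
  · simp at hr

theorem Database.length_eq {D : Database} {a : Atom ℕ} (h : D.Declares a) {R : RelInstance}
    (hR : R ∈ D.rels) (hs : R.sym = a.rel) {u : List ℕ} (hu : u ∈ R.tuples) :
    u.length = a.args.length := by
  obtain ⟨R', hR', hs', har⟩ := h
  obtain rfl : R = R' := List.inj_on_of_nodup_map D.nodup_sym hR hR' (hs.trans hs'.symm)
  rw [D.length_tuple R hR u hu, har]

theorem mem_atomRows {D : Database} {a : Atom ℕ} {r : Row} :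
    r ∈ atomRows D a ↔ ∃ R ∈ D.rels, R.sym = a.rel ∧ ∃ u ∈ R.tuples, r ∈ matchRow a.args u := by
  simp only [atomRows, List.mem_flatMap]
  refine exists_congr fun R => and_congr_right fun _ => ?_
  by_cases h : R.sym = a.rel <;> simp [h]

theorem exists_atomRows {D : Database} {a : Atom ℕ} (h : D.Declares a) {θ : ℕ → ℕ} :
    (∃ r ∈ atomRows D a, Extends θ r) ↔ θ ∈ a.sols D := by
  constructor
  · rintro ⟨r, hr, hθ⟩
    obtain ⟨R, hR, hs, u, hu, hr⟩ := mem_atomRows.1 hr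
    refine ⟨R, hR, hs, ?_⟩
    rwa [(exists_matchRow (D.length_eq h hR hs hu)).1 ⟨r, hr, hθ⟩]
  · rintro ⟨R, hR, hs, hu⟩
    obtain ⟨r, hr, hθ⟩ := (exists_matchRow (D.length_eq h hR hs hu)).2 rfl
    exact ⟨r, mem_atomRows.2 ⟨R, hR, hs, _, hu, hr⟩, hθ⟩

theorem isRowOn_of_mem_atomRows {D : Database} {a : Atom ℕ} (h : D.Declares a) {r : Row}
    (hr : r ∈ atomRows D a) : IsRowOn a.vars r := by
  obtain ⟨R, hR, hs, u, hu, hr⟩ := mem_atomRows.1 hr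
  exact isRowOn_of_mem_matchRow (D.length_eq h hR hs hu) hr

theorem Term.eval_congr {θ τ : ℕ → ℕ} {t : Term} (h : ∀ x, t = .var x → θ x = τ x) :
    t.eval θ = t.eval τ := by
  cases t with
  | var x => exact h x rfl
  | const c => rfl

theorem Atom.sols_congr {a : Atom ℕ} {D : Database} {θ τ : ℕ → ℕ} (h : ∀ x ∈ a.vars, θ x = τ x) :
    θ ∈ a.sols D ↔ τ ∈ a.sols D := by
  have : a.args.map (Term.eval θ) = a.args.map (Term.eval τ) :=
    List.map_congr_left fun t ht => Term.eval_congr fun x hx =>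
      h x (show Term.var x ∈ a.args from hx ▸ ht)
  simp only [Atom.sols, Set.mem_ofPred_eq, this]

theorem coveredBy_iff {h : List ℕ} {a : Atom ℕ} :
    coveredBy h a = true ↔ {x | x ∈ h} ⊆ a.vars := by
  simp only [coveredBy, List.all_eq_true, List.any_eq_true, Bool.and_eq_true,
    Bool.not_eq_true', decide_eq_true_eq]
  refine forall₂_congr fun x _ => ⟨?_, fun hx => ⟨_, hx, rfl, rfl⟩⟩
  rintro ⟨t, ht, h1, rfl⟩
  cases t with
  | var y => exact ht
  | const y => simp [Term.isConst] at h1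

theorem isInside_iff {h : List ℕ} {a : Atom ℕ} :
    isInside a h = true ↔ a.vars ⊆ {x | x ∈ h} := by
  simp only [isInside, List.all_eq_true, Bool.or_eq_true, List.any_eq_true, decide_eq_true_eq,
    exists_eq_right]
  constructor
  · intro H x hx
    simpa [Term.isConst, Term.name] using H _ hx
  · intro H t ht
    cases t with
    | var x => exact .inr (H ht)
    | const c => exact .inl rfl

theorem mem_restrictRow {h : List ℕ} {r : Row} {x c : ℕ} :
    (x, c) ∈ restrictRow h r ↔ (x, c) ∈ r ∧ x ∈ h := by
  simp [restrictRow]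

theorem IsRowOn.restrictRow {e : Set ℕ} {r : Row} (hr : IsRowOn e r) {h : List ℕ}
    (hh : {x | x ∈ h} ⊆ e) : IsRowOn {x | x ∈ h} (restrictRow h r) := by
  constructor
  · ext x
    simp only [keys, mem_restrictRow, Set.mem_ofPred_eq]
    refine ⟨fun ⟨c, hc⟩ => hc.2, fun hx => ?_⟩
    have : x ∈ keys r := hr.1 ▸ hh hx
    obtain ⟨c, hc⟩ := this
    exact ⟨c, hc, hx⟩
  · have := hr.2
    simp only [compat_iff, mem_restrictRow] at *
    exact fun x c d hc hd => this x c d hc.1 hd.1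

/-- If `θ` extends a row, it extends every compatible row over fewer variables. -/
theorem Extends.of_compat {θ : ℕ → ℕ} {r s : Row} (h : Extends θ r) (hk : keys s ⊆ keys r)
    (hc : compat r s = true) : Extends θ s := by
  intro x c hx
  obtain ⟨d, hd⟩ := hk ⟨c, hx⟩
  rw [h x d hd]
  exact compat_iff.1 hc x d c hd hx

theorem Extends.restrictRow {θ : ℕ → ℕ} {r : Row} (h : Extends θ r) (l : List ℕ) :
    Extends θ (restrictRow l r) := fun x c hc => h x c (mem_restrictRow.1 hc).1

/-! ### The join over the hyperedges of the decomposition -/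

/-- `θ` extends a row of the join of `F`. -/
def Solves (θ : ℕ → ℕ) (F : List (Entry Bin)) : Prop := ∀ e ∈ F, ∃ t ∈ e.2, Extends θ t.1

/-- The test whether a row of `e` extends to the join adds the relation that consists of this row.
The join stays acyclic, as the new relation is over the same variables as `e`. -/
theorem isExtendible_iff {F : List (Entry Bin)} (hF : IsAcyclicJoin F)
    (hone : ∀ e ∈ F, ∀ t ∈ e.2, t.2 = 1) {e : Entry Bin} (he : e ∈ F) {t : Row × Bin}
    (ht : t ∈ e.2) :
    isExtendible F e.1 t.1 = true ↔ ∃ θ, Extends θ t.1 ∧ Solves θ F := by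
  have hone' : ∀ e' ∈ ((e.1, [(t.1, 1)]) : Entry Bin) :: F, ∀ s ∈ e'.2, s.2 = 1 := by
    intro e' he' s hs
    rcases List.mem_cons.1 he' with rfl | he'
    · obtain rfl : s = (t.1, 1) := by simpa using hs
      rfl
    · exact hone e' he' s hs
  have hwf : WellFormed (((e.1, [(t.1, 1)]) : Entry Bin) :: F) := by
    intro e' he' s hs
    rcases List.mem_cons.1 he' with rfl | he'
    · obtain rfl : s = (t.1, 1) := by simpa using hs
      exact hF.wellFormed e he t ht
    · exact hF.wellFormed e' he' s hs
  have hac : IsAcyclicJoin (((e.1, [(t.1, 1)]) : Entry Bin) :: F) :=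
    ⟨hwf, hF.acyclic.cons (.of_mem (List.mem_map.2 ⟨e, he, rfl⟩))⟩
  have hnat : ∀ n : ℕ, ((n : Bin) = 0) ↔ n = 0 := by
    intro n
    rw [Bin.ext_iff, Bin.val_natCast, Bin.val_zero]
  rw [isExtendible, countJoin_eq hac (by simp), joinWeight_eq_length hone', Bool.not_eq_true',
    decide_eq_false_iff_not, hnat, List.length_eq_zero_iff]
  have h2 : ∀ θ, (∃ s ∈ joinRows (((e.1, [(t.1, 1)]) : Entry Bin) :: F) [], Extends θ s) ↔
      Extends θ t.1 ∧ Solves θ F := by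
    intro θ
    rw [exists_joinRows]
    have : Extends θ [] := fun x c h => by simp at h
    simp [this, Solves]
  constructor
  · intro h
    obtain ⟨s, hs⟩ := List.exists_mem_of_ne_nil _ h
    have hs' := joinRows_isRowOn hwf (r := []) (U := ∅) ⟨by ext; simp [keys], rfl⟩ hs
    exact ⟨_, (h2 _).1 ⟨s, hs, extends_rowValue hs'.2⟩⟩
  · rintro ⟨θ, hθ⟩
    obtain ⟨s, hs, -⟩ := (h2 θ).2 hθ
    exact List.ne_nil_of_mem hs

section Base

variable {Q : Query} {V : List (Atom ℕ)} {D : Database} {L : HypergraphList}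

theorem mem_viewRows {h : List ℕ} {r : Row} :
    r ∈ viewRows V D h ↔ ∃ w ∈ V, {x | x ∈ h} ⊆ w.vars ∧
      ∃ s ∈ atomRows D w, restrictRow h s = r := by
  simp only [viewRows, List.mem_flatMap]
  refine exists_congr fun w => and_congr_right fun _ => ?_
  rw [← coveredBy_iff]
  by_cases hc : coveredBy h w <;> simp [hc]

theorem mem_baseJoin {e : Entry Bin} :
    e ∈ baseJoin Q V D L ↔ ∃ h ∈ L.edges, baseEntry Q V D h = e := by
  simp [baseJoin]

theorem mem_baseEntry {h : List ℕ} {t : Row × Bin} :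
    t ∈ (baseEntry Q V D h).2 ↔
      t.2 = 1 ∧ t.1 ∈ viewRows V D h ∧ satisfiesInside Q D h t.1 = true := by
  obtain ⟨r, k⟩ := t
  simp only [baseEntry, List.mem_map, List.mem_filter, Prod.mk.injEq]
  constructor
  · rintro ⟨s, h1, rfl, rfl⟩
    exact ⟨rfl, h1⟩
  · rintro ⟨rfl, h1⟩
    exact ⟨r, h1, rfl, rfl⟩

theorem baseJoin_weight_eq_one : ∀ e ∈ baseJoin Q V D L, ∀ t ∈ e.2, t.2 = 1 := by
  intro e he t ht
  obtain ⟨h, -, rfl⟩ := mem_baseJoin.1 he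
  exact (mem_baseEntry.1 ht).1

theorem isAcyclicJoin_baseJoin (hV : ∀ w ∈ V, D.Declares w) (hL : IsAcyclic L.toHypergraph) :
    IsAcyclicJoin (baseJoin Q V D L) := by
  refine ⟨fun e he t ht => ?_, ?_⟩
  · obtain ⟨h, -, rfl⟩ := mem_baseJoin.1 he
    obtain ⟨-, h1, -⟩ := mem_baseEntry.1 ht
    obtain ⟨w, hw, hh, s, hs, hst⟩ := mem_viewRows.1 h1
    rw [← hst]
    exact (isRowOn_of_mem_atomRows (hV w hw) hs).restrictRow hh
  · have : (baseJoin Q V D L).map edgeOf = L.edges.map fun l => {x | x ∈ l} := by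
      rw [baseJoin, List.map_map]
      rfl
    rw [this]
    exact hL.acyclicList

/-- The answers to the query solve the join over the decomposition. -/
theorem solves_baseJoin {wq : Atom ℕ → Atom ℕ} (hD : IsLegal Q V wq D)
    (hL : Covers L.toHypergraph (hypergraphOf {w | w ∈ V})) {θ : ℕ → ℕ} (hθ : θ ∈ Q.sols D) :
    Solves θ (baseJoin Q V D L) := by
  intro e he
  obtain ⟨h, hh, rfl⟩ := mem_baseJoin.1 he
  obtain ⟨_, ⟨w, hw, rfl⟩, hhw⟩ := hL {x | x ∈ h} ⟨h, hh, rfl⟩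
  obtain ⟨τ, hτ, hτθ⟩ := hD.view_superset w hw ⟨θ, hθ, rfl⟩
  have hθw : θ ∈ w.sols D := (Atom.sols_congr fun x hx => congrFun hτθ ⟨x, hx⟩).1 hτ
  obtain ⟨s, hs, hsθ⟩ := (exists_atomRows (hD.declares_view w hw)).2 hθw
  refine ⟨(restrictRow h s, 1), mem_baseEntry.2 ⟨rfl, mem_viewRows.2 ⟨w, hw, hhw, s, hs, rfl⟩, ?_⟩,
    hsθ.restrictRow h⟩
  rw [satisfiesInside, List.all_eq_true]
  intro q hq
  obtain ⟨u, hu, huθ⟩ := (exists_atomRows (hD.declares_query q hq)).2 (hθ q hq)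
  rw [Bool.or_eq_true, List.any_eq_true]
  exact .inr ⟨u, hu, compat_of_extends (hsθ.restrictRow h) huθ⟩

/-- The solutions of the join over the decomposition satisfy the atoms that a hyperedge covers. -/
theorem mem_sols_of_solves {wq : Atom ℕ → Atom ℕ} (hD : IsLegal Q V wq D) {θ : ℕ → ℕ}
    (hθ : Solves θ (baseJoin Q V D L)) {q : Atom ℕ} (hq : q ∈ Q.atoms) {h : List ℕ}
    (hh : h ∈ L.edges) (hqh : q.vars ⊆ {x | x ∈ h}) : θ ∈ q.sols D := by
  obtain ⟨t, ht, htθ⟩ := hθ _ (mem_baseJoin.2 ⟨h, hh, rfl⟩)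
  obtain ⟨-, h1, h2⟩ := mem_baseEntry.1 ht
  obtain ⟨w, hw, hhw, s, hs, hst⟩ := mem_viewRows.1 h1
  rw [satisfiesInside, List.all_eq_true] at h2
  have h3 := h2 q hq
  rw [isInside_iff.2 hqh, Bool.or_eq_true, List.any_eq_true] at h3
  obtain ⟨u, hu, hc⟩ := h3.resolve_left (by simp)
  refine (exists_atomRows (hD.declares_query q hq)).1 ⟨u, hu, htθ.of_compat ?_ hc⟩
  rw [(isRowOn_of_mem_atomRows (hD.declares_query q hq) hu).1, ← hst,
    ((isRowOn_of_mem_atomRows (hD.declares_view w hw) hs).restrictRow hhw).1]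
  exact hqh

end Base

/-! ### The join over the free variables -/

theorem mem_of_mem_dedupRows {l : List Row} {r : Row} (h : r ∈ dedupRows l) : r ∈ l := by
  have key : ∀ (l acc : List Row), r ∈ l.foldl (fun acc r =>
      if acc.any fun s => compat r s then acc else r :: acc) acc → r ∈ l ∨ r ∈ acc := by
    intro l
    induction l with
    | nil => exact fun acc h => .inr h
    | cons a l ih =>
      intro acc h
      rw [List.foldl_cons] at h
      rcases ih _ h with h | h
      · exact .inl (List.mem_cons_of_mem _ h)
      · split at h
        · exact .inr h
        · rcases List.mem_cons.1 h with rfl | h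
          · exact .inl (List.mem_cons_self ..)
          · exact .inr h
  simpa using key l [] h

theorem exists_compat_dedupRows {l : List Row} {r : Row} (h : r ∈ l) (hr : compat r r = true) :
    ∃ s ∈ dedupRows l, compat r s = true := by
  have key : ∀ (l acc : List Row), (r ∈ l ∨ ∃ s ∈ acc, compat r s = true) →
      ∃ s ∈ l.foldl (fun acc r => if acc.any fun s => compat r s then acc else r :: acc) acc,
        compat r s = true := by
    intro l
    induction l with
    | nil => exact fun acc h => h.resolve_left (by simp)
    | cons a l ih =>
      intro acc h
      rw [List.foldl_cons]
      refine ih _ ?_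
      rcases h with h | ⟨s, hs, hrs⟩
      · rcases List.mem_cons.1 h with rfl | h
        · right
          split
          · rename_i hc
            exact List.any_eq_true.1 hc
          · exact ⟨r, List.mem_cons_self .., hr⟩
        · exact .inl h
      · right
        split
        · exact ⟨s, hs, hrs⟩
        · exact ⟨s, List.mem_cons_of_mem _ hs, hrs⟩
  exact key l [] (.inl h)

theorem pairwise_dedupRows (l : List Row) :
    (dedupRows l).Pairwise fun r s => compat r s = false := by
  have key : ∀ (l acc : List Row), (acc.Pairwise fun r s => compat r s = false) →
      (l.foldl (fun acc r => if acc.any fun s => compat r s then acc else r :: acc) acc).Pairwise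
        fun r s => compat r s = false := by
    intro l
    induction l with
    | nil => exact fun acc h => h
    | cons a l ih =>
      intro acc h
      rw [List.foldl_cons]
      refine ih _ ?_
      split
      · exact h
      · rename_i hc
        refine List.pairwise_cons.2 ⟨fun s hs => ?_, h⟩
        rw [Bool.eq_false_iff]
        exact fun hcs => hc (List.any_eq_true.2 ⟨s, hs, hcs⟩)
  exact key l [] List.Pairwise.nil

section Free

variable {Q : Query} {F : List (Entry Bin)}

theorem mem_freePart {h : List ℕ} {x : ℕ} : x ∈ freePart Q h ↔ x ∈ h ∧ x ∉ Q.quantified := by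
  simp only [freePart, List.mem_filter, Bool.not_eq_true', ← Bool.not_eq_true, List.any_eq_true,
    decide_eq_true_eq, exists_eq_right']

theorem mem_freeJoin {e : Entry Bin} : e ∈ freeJoin Q F ↔ ∃ f ∈ F, freeEntry Q F f = e := by
  simp [freeJoin]

theorem freeJoin_weight_eq_one : ∀ e ∈ freeJoin Q F, ∀ t ∈ e.2, t.2 = 1 := by
  intro e he t ht
  obtain ⟨f, -, rfl⟩ := mem_freeJoin.1 he
  obtain ⟨r, -, rfl⟩ := List.mem_map.1 ht
  rfl

theorem pairwise_freeJoin :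
    ∀ e ∈ freeJoin Q F, e.2.Pairwise fun t s => compat t.1 s.1 = false := by
  intro e he
  obtain ⟨f, -, rfl⟩ := mem_freeJoin.1 he
  exact List.pairwise_map.2 (pairwise_dedupRows _)

theorem mem_freeEntry {e : Entry Bin} {t : Row × Bin} (ht : t ∈ (freeEntry Q F e).2) :
    ∃ s ∈ e.2, isExtendible F e.1 s.1 = true ∧ restrictRow (freePart Q e.1) s.1 = t.1 := by
  obtain ⟨r, hr, rfl⟩ := List.mem_map.1 ht
  obtain ⟨s, hs, rfl⟩ := List.mem_map.1 (mem_of_mem_dedupRows hr)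
  obtain ⟨h1, h2⟩ := List.mem_filter.1 hs
  exact ⟨s, h1, h2, rfl⟩

theorem isAcyclicJoin_freeJoin (hF : IsAcyclicJoin F) : IsAcyclicJoin (freeJoin Q F) := by
  refine ⟨fun e he t ht => ?_, ?_⟩
  · obtain ⟨f, hf, rfl⟩ := mem_freeJoin.1 he
    obtain ⟨s, hs, -, hst⟩ := mem_freeEntry ht
    rw [← hst]
    exact (hF.wellFormed f hf s hs).restrictRow fun x hx => (mem_freePart.1 hx).1
  · have : (freeJoin Q F).map edgeOf = (F.map edgeOf).map (· ∩ {x | x ∉ Q.quantified}) := by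
      rw [freeJoin, List.map_map, List.map_map]
      refine List.map_congr_left fun e _ => ?_
      ext x
      exact mem_freePart
    rw [this]
    exact hF.acyclic.map_inter _

/-- `θ` solves the join over the free variables if, on the free variables of each hyperedge, it
agrees with a solution of the join over the decomposition. -/
theorem solves_freeJoin_iff (hF : IsAcyclicJoin F)
    (hone : ∀ e ∈ F, ∀ t ∈ e.2, t.2 = 1) {θ : ℕ → ℕ} :
    Solves θ (freeJoin Q F) ↔
      ∀ e ∈ F, ∃ τ, Solves τ F ∧ ∀ x ∈ freePart Q e.1, θ x = τ x := by
  constructor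
  · intro h e he
    obtain ⟨t, ht, htθ⟩ := h _ (mem_freeJoin.2 ⟨e, he, rfl⟩)
    obtain ⟨s, hs, hse, hst⟩ := mem_freeEntry ht
    obtain ⟨τ, hsτ, hτ⟩ := (isExtendible_iff hF hone he hs).1 hse
    refine ⟨τ, hτ, fun x hx => ?_⟩
    have hxs : x ∈ keys s.1 := (hF.wellFormed e he s hs).1 ▸ (mem_freePart.1 hx).1
    obtain ⟨c, hc⟩ := hxs
    rw [hsτ x c hc]
    exact htθ x c (hst ▸ mem_restrictRow.2 ⟨hc, hx⟩)
  · intro h _ hmem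
    obtain ⟨e, he, rfl⟩ := mem_freeJoin.1 hmem
    obtain ⟨τ, hτ, hθ⟩ := h e he
    obtain ⟨s, hs, hsτ⟩ := hτ e he
    have hrow : IsRowOn {x | x ∈ freePart Q e.1} (restrictRow (freePart Q e.1) s.1) :=
      (hF.wellFormed e he s hs).restrictRow fun x hx => (mem_freePart.1 hx).1
    have hrest : restrictRow (freePart Q e.1) s.1 ∈
        ((e.2.filter fun t => isExtendible F e.1 t.1).map
          fun t => restrictRow (freePart Q e.1) t.1) :=
      List.mem_map.2 ⟨s, List.mem_filter.2 ⟨hs,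
        (isExtendible_iff hF hone he hs).2 ⟨τ, hsτ, hτ⟩⟩, rfl⟩
    obtain ⟨r, hr, hc⟩ := exists_compat_dedupRows hrest hrow.2
    refine ⟨(r, 1), List.mem_map.2 ⟨r, hr, rfl⟩, ?_⟩
    have hθr : Extends θ (restrictRow (freePart Q e.1) s.1) := fun x c hx => by
      obtain ⟨h1, h2⟩ := mem_restrictRow.1 hx
      rw [hθ x h2]
      exact hsτ x c h1
    refine hθr.of_compat ?_ hc
    obtain ⟨u, hu, rfl⟩ := List.mem_map.1 (mem_of_mem_dedupRows hr)
    rw [hrow.1, ((hF.wellFormed e he u (List.mem_filter.1 hu).1).restrictRow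
      fun x hx => (mem_freePart.1 hx).1).1]

end Free

/-! ### The answers are determined by the frontiers -/

theorem component_eq {H : Hypergraph ℕ} {W : Set ℕ} {h : Set ℕ} (hh : h ∈ H.edgeSet) {y z : ℕ}
    (hy : y ∈ h \ W) (hz : z ∈ h \ W) : component H W y = component H W z := by
  have key : ∀ {y z : ℕ}, y ∈ h \ W → z ∈ h \ W → component H W y ⊆ component H W z :=
    fun hy hz x hx => ⟨hx.1, .head ⟨h, hh, hz, hy⟩ hx.2⟩
  exact (key hy hz).antisymm (key hz hy)

theorem mem_component_self {H : Hypergraph ℕ} {W : Set ℕ} {h : Set ℕ} (hh : h ∈ H.edgeSet)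
    {y : ℕ} (hy : y ∈ h \ W) : y ∈ component H W y :=
  ⟨⟨H.subset_vertexSet_of_mem_edgeSet hh hy.1, hy.2⟩, .refl⟩

/-- Solutions of local constraints can be glued along the frontiers: let `S` be a set of
substitutions and let `θ` agree, on the part in `W` of every hyperedge of `E`, with a member of `S`.
If `E` covers the hypergraph and the frontier hypergraph of `A`, then `θ` can be changed outside `W`
such that, on every atom of `A`, the result agrees with a member of `S`. -/
theorem exists_glue {S : Set (ℕ → ℕ)} {A : Set (Atom (ℕ ⊕ ℕ))} {W : Set ℕ} {E : Set (Set ℕ)}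
    {θ : ℕ → ℕ} (hθ : ∀ e ∈ E, ∃ τ ∈ S, ∀ x ∈ e ∩ W, θ x = τ x)
    (hA : ∀ a ∈ A, ∃ e ∈ E, a.vars ⊆ e)
    (hW : ∀ f ∈ (frontierHypergraph A W).edgeSet, ∃ e ∈ E, f ⊆ e) :
    ∃ σ : ℕ → ℕ, (∀ x ∈ W, σ x = θ x) ∧ ∀ a ∈ A, ∃ τ ∈ S, ∀ x ∈ a.vars, σ x = τ x := by
  classical
  set H := hypergraphOf A with hH
  -- one member of `S` is chosen for each component, rather than for each variable
  let Good : Set ℕ → (ℕ → ℕ) → Prop := fun C τ =>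
    τ ∈ S ∧ ∀ x ∈ W, (∃ h ∈ H.edgeSet, (h ∩ C).Nonempty ∧ x ∈ h) → θ x = τ x
  have hgood : ∀ y ∈ varsOf A, y ∉ W → ∃ τ, Good (component H W y) τ := by
    intro y hy hyW
    obtain ⟨e, he, hfe⟩ := hW (frontierOf y W H) (.inl ⟨y, hy, rfl⟩)
    obtain ⟨τ, hτ, hτθ⟩ := hθ e he
    exact ⟨τ, hτ, fun x hx hxh => hτθ x ⟨hfe ⟨hyW, hx, hxh⟩, hx⟩⟩
  let pick : Set ℕ → ℕ → ℕ := fun C => if h : ∃ τ, Good C τ then h.choose else θ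
  have hpick : ∀ C, (∃ τ, Good C τ) → Good C (pick C) := by
    intro C h
    simp only [pick, dif_pos h]
    exact h.choose_spec
  refine ⟨fun x => if x ∈ W then θ x else pick (component H W x) x,
    fun x hx => if_pos hx, fun a ha => ?_⟩
  have haH : a.vars ∈ H.edgeSet := ⟨a, ha, rfl⟩
  by_cases hsub : a.vars ⊆ W
  · obtain ⟨e, he, hae⟩ := hA a ha
    obtain ⟨τ, hτ, hτθ⟩ := hθ e he
    refine ⟨τ, hτ, fun x hx => ?_⟩
    simp only [if_pos (hsub hx)]
    exact hτθ x ⟨hae hx, hsub hx⟩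
  · obtain ⟨y, hy, hyW⟩ := Set.not_subset.1 hsub
    obtain ⟨h1, h2⟩ := hpick _ (hgood y ⟨a, ha, hy⟩ hyW)
    refine ⟨_, h1, fun x hx => ?_⟩
    by_cases hxW : x ∈ W
    · simp only [if_pos hxW]
      exact h2 x hxW ⟨a.vars, haH, ⟨y, hy, mem_component_self haH ⟨hy, hyW⟩⟩, hx⟩
    · simp only [if_neg hxW]
      rw [component_eq haH ⟨hx, hxW⟩ ⟨hy, hyW⟩]

/-- A homomorphism from the coloured query to a set of its atoms turns a substitution that satisfies
these atoms into one that satisfies the query and has the same restriction to the free variables. -/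
theorem exists_mem_sols_of_hasHom {Q : Query} {D : Database} {A : Set (Atom (ℕ ⊕ ℕ))}
    (hAQ : A ⊆ Q.color) (hA : HasHom Q.color A) {σ : ℕ → ℕ}
    (hσ : ∀ a ∈ Q.atoms, (⟨Sum.inl a.rel, a.args⟩ : Atom (ℕ ⊕ ℕ)) ∈ A → σ ∈ a.sols D) :
    ∃ τ ∈ Q.sols D, ∀ x ∈ Q.free, τ x = σ x := by
  obtain ⟨h, hc, hh⟩ := hA
  refine ⟨fun x => (h (.var x)).eval σ, fun a ha => ?_, fun x hx => ?_⟩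
  · have h1 : (⟨Sum.inl a.rel, a.args.map h⟩ : Atom (ℕ ⊕ ℕ)) ∈ A :=
      hh ⟨Sum.inl a.rel, a.args⟩ (.inl ⟨a, ha, rfl⟩)
    have h2 : σ ∈ (⟨a.rel, a.args.map h⟩ : Atom ℕ).sols D := by
      rcases hAQ h1 with ⟨b, hb, he⟩ | ⟨x, -, he⟩
      · simp only [Atom.mk.injEq, Sum.inl.injEq] at he
        have : b = ⟨a.rel, a.args.map h⟩ := by rw [he.1, he.2]
        exact this ▸ hσ b hb (by rwa [← he.1, ← he.2])
      · simp at he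
    have h3 : (a.args.map h).map (Term.eval σ)
        = a.args.map (Term.eval fun x => (h (.var x)).eval σ) := by
      rw [List.map_map]
      refine List.map_congr_left fun t _ => ?_
      cases t with
      | var x => rfl
      | const c => simp [hc, Term.eval]
    change D.Holds _ _ at h2 ⊢
    rwa [h3] at h2
  · rcases hAQ (hh ⟨Sum.inr x, [.var x]⟩ (.inr ⟨x, hx, rfl⟩)) with ⟨b, -, he⟩ | ⟨y, -, he⟩
    · simp at he
    · simp only [List.map_cons, List.map_nil, Atom.mk.injEq, Sum.inr.injEq, List.cons.injEq,
        and_true] at he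
      change (h (.var x)).eval σ = σ x
      rw [he.2, ← he.1]
      rfl

/-- The colour atom of a free variable belongs to every homomorphic image of the coloured query. -/
theorem color_mem_of_hasHom {Q : Query} {A : Set (Atom (ℕ ⊕ ℕ))} (hAQ : A ⊆ Q.color)
    (hA : HasHom Q.color A) {x : ℕ} (hx : x ∈ Q.free) :
    (⟨Sum.inr x, [.var x]⟩ : Atom (ℕ ⊕ ℕ)) ∈ A := by
  obtain ⟨h, -, hh⟩ := hA
  have h1 := hh ⟨Sum.inr x, [.var x]⟩ (.inr ⟨x, hx, rfl⟩)
  rcases hAQ h1 with ⟨b, -, he⟩ | ⟨y, -, he⟩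
  · simp at he
  · simp only [List.map_cons, List.map_nil, Atom.mk.injEq, Sum.inr.injEq, List.cons.injEq,
      and_true] at he
    simpa [he.2, ← he.1] using h1

/-! ### Correctness of the algorithm -/

section Correct

variable {Q : Query} {V : List (Atom ℕ)} {wq : Atom ℕ → Atom ℕ} {D : Database}
  {L : HypergraphList}

/-- A substitution solves the join over the free variables if and only if its restriction to the
free variables is an answer. -/
theorem solves_freeJoin_baseJoin_iff (hV : IsViewSet Q V wq) (hD : IsLegal Q V wq D)
    (hL : IsSharpDecomposition Q V L.toHypergraph) {θ : ℕ → ℕ} :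
    Solves θ (freeJoin Q (baseJoin Q V D L)) ↔ ∃ τ ∈ Q.sols D, ∀ x ∈ Q.free, τ x = θ x := by
  obtain ⟨A, hA, ⟨hac, hAL, hLV⟩, hfr⟩ := hL
  have hbase := isAcyclicJoin_baseJoin (Q := Q) hD.declares_view hac
  rw [solves_freeJoin_iff hbase baseJoin_weight_eq_one]
  constructor
  · intro h
    obtain ⟨σ, hσθ, hσ⟩ := exists_glue (S := {τ | Solves τ (baseJoin Q V D L)}) (A := A)
      (W := Q.free) (E := L.toHypergraph.edgeSet) (θ := θ) (by
        rintro _ ⟨l, hl, rfl⟩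
        obtain ⟨τ, hτ, hτθ⟩ := h _ (mem_baseJoin.2 ⟨l, hl, rfl⟩)
        exact ⟨τ, hτ, fun x hx => hτθ x (mem_freePart.2 ⟨hx.1, hx.2.2⟩)⟩)
      (fun a ha => hAL _ ⟨a, ha, rfl⟩) hfr
    obtain ⟨τ, hτ, hτσ⟩ := exists_mem_sols_of_hasHom (D := D) (σ := σ) hA.prop.1 hA.prop.2
      fun a ha haA => by
        obtain ⟨τ, hτ, hστ⟩ := hσ _ haA
        obtain ⟨_, ⟨l, hl, rfl⟩, hal⟩ := hAL _ ⟨_, haA, rfl⟩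
        exact (Atom.sols_congr hστ).2 (mem_sols_of_solves hD hτ ha hl hal)
    exact ⟨τ, hτ, fun x hx => (hτσ x hx).trans (hσθ x hx)⟩
  · rintro ⟨τ, hτ, hτθ⟩ e he
    refine ⟨τ, solves_baseJoin hD hLV hτ, fun x hx => (hτθ x ?_).symm⟩
    obtain ⟨hxe, hxq⟩ := mem_freePart.1 hx
    obtain ⟨l, hl, rfl⟩ := mem_baseJoin.1 he
    obtain ⟨_, ⟨w, hw, rfl⟩, hlw⟩ := hLV _ ⟨l, hl, rfl⟩
    exact ⟨hV.vars_subset w hw (hlw hxe), hxq⟩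

theorem nodesOf_freeJoin_baseJoin (hV : IsViewSet Q V wq)
    (hL : IsSharpDecomposition Q V L.toHypergraph) :
    nodesOf (freeJoin Q (baseJoin Q V D L)) = Q.free := by
  obtain ⟨A, hA, ⟨hac, hAL, hLV⟩, hfr⟩ := hL
  ext x
  rw [mem_nodesOf]
  constructor
  · rintro ⟨e, he, hx⟩
    obtain ⟨f, hf, rfl⟩ := mem_freeJoin.1 he
    obtain ⟨l, hl, rfl⟩ := mem_baseJoin.1 hf
    obtain ⟨hxe, hxq⟩ := mem_freePart.1 hx
    obtain ⟨_, ⟨w, hw, rfl⟩, hlw⟩ := hLV _ ⟨l, hl, rfl⟩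
    exact ⟨hV.vars_subset w hw (hlw hxe), hxq⟩
  · intro hx
    obtain ⟨_, ⟨l, hl, rfl⟩, hxl⟩ :=
      hAL _ ⟨_, color_mem_of_hasHom hA.prop.1 hA.prop.2 hx, rfl⟩
    have hxl' : x ∈ l := hxl (by simp [Atom.vars])
    exact ⟨_, mem_freeJoin.2 ⟨_, mem_baseJoin.2 ⟨l, hl, rfl⟩, rfl⟩,
      mem_freePart.2 ⟨hxl', hx.2⟩⟩

theorem countAnswers_eq (hV : IsViewSet Q V wq) (hD : IsLegal Q V wq D)
    (hL : IsSharpDecomposition Q V L.toHypergraph) :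
    (countAnswers Q V D L).val = count Q D := by
  classical
  have hnodes := nodesOf_freeJoin_baseJoin (D := D) hV hL
  have hsolves := fun θ => solves_freeJoin_baseJoin_iff hV hD hL (θ := θ)
  have hac : IsAcyclicJoin (freeJoin Q (baseJoin Q V D L)) := by
    obtain ⟨A, hA, ⟨hac, -, -⟩, -⟩ := hL
    exact isAcyclicJoin_freeJoin (isAcyclicJoin_baseJoin hD.declares_view hac)
  have hne : freeJoin Q (baseJoin Q V D L) ≠ [] := by
    obtain ⟨A, hA, ⟨-, hAL, -⟩, -⟩ := hL
    obtain ⟨h, -, hh⟩ := hA.prop.2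
    obtain ⟨a, ha⟩ := List.exists_mem_of_ne_nil _ Q.atoms_ne_nil
    obtain ⟨_, ⟨l, hl, rfl⟩, -⟩ := hAL _ ⟨_, hh _ (.inl ⟨a, ha, rfl⟩), rfl⟩
    exact List.ne_nil_of_mem (mem_freeJoin.2 ⟨_, mem_baseJoin.2 ⟨l, hl, rfl⟩, rfl⟩)
  rw [countAnswers, countJoin_eq hac hne, joinWeight_eq_length freeJoin_weight_eq_one,
    Bin.val_natCast, count]
  have hpair := pairwise_joinRows (pairwise_freeJoin (Q := Q) (F := baseJoin Q V D L)) []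
  have hrow : ∀ s ∈ joinRows (freeJoin Q (baseJoin Q V D L)) [], IsRowOn Q.free s := by
    intro s hs
    have := joinRows_isRowOn hac.wellFormed (r := []) (U := ∅) ⟨by ext; simp [keys], rfl⟩ hs
    rwa [hnodes, Set.union_empty] at this
  have hext : ∀ θ, (∃ s ∈ joinRows (freeJoin Q (baseJoin Q V D L)) [], Extends θ s) ↔
      Solves θ (freeJoin Q (baseJoin Q V D L)) := by
    intro θ
    rw [exists_joinRows]
    exact and_iff_right fun x c h => by simp at h
  generalize joinRows (freeJoin Q (baseJoin Q V D L)) [] = J at hpair hrow hext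
  -- the rows of the join are in bijection with the answers
  let g : Row → Q.free → ℕ := fun s x => rowValue s x
  have hnd : (J.map g).Nodup := by
    refine List.pairwise_map.2 (hpair.imp_of_mem fun {s t} hs ht hst heq => ?_)
    rw [Bool.eq_false_iff] at hst
    refine hst (compat_iff.2 fun x c d hc hd => ?_)
    have hx : x ∈ Q.free := (hrow s hs).1 ▸ ⟨c, hc⟩
    rw [← extends_rowValue (hrow s hs).2 x c hc, ← extends_rowValue (hrow t ht).2 x d hd]
    exact congrFun heq ⟨x, hx⟩
  have hset : Q.answers D = ((J.map g).toFinset : Set (Q.free → ℕ)) := by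
    ext φ
    simp only [List.coe_toFinset, List.mem_map, Set.mem_ofPred_eq]
    constructor
    · rintro ⟨τ, hτ, rfl⟩
      obtain ⟨s, hs, hsτ⟩ := (hext τ).2 ((hsolves τ).2 ⟨τ, hτ, fun _ _ => rfl⟩)
      refine ⟨s, hs, funext fun x => ?_⟩
      obtain ⟨c, hc⟩ : x.1 ∈ keys s := (hrow s hs).1.symm ▸ x.2
      exact (extends_rowValue (hrow s hs).2 x c hc).trans (hsτ x c hc).symm
    · rintro ⟨s, hs, rfl⟩
      obtain ⟨τ, hτ, hτs⟩ := (hsolves _).1 ((hext _).1 ⟨s, hs, extends_rowValue (hrow s hs).2⟩)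
      exact ⟨τ, hτ, funext fun x => hτs x x.2⟩
  rw [hset, Set.ncard_coe_finset, List.toFinset_card_of_nodup hnd, List.length_map]

end Correct

end CountCQ

theorem mainTheorem3 :
    ∃ (p : Prog) (P : Polynomial ℕ),
      ∀ (Q : Query) (V : List (Atom ℕ)) (wq : Atom ℕ → Atom ℕ) (D : Database)
        (Ha : HypergraphList),
        IsViewSet Q V wq → IsLegal Q V wq D → IsSharpDecomposition Q V Ha.toHypergraph →
          ∃ t : ℕ, t ≤ P.eval (Q.size + D.size + Ha.size) ∧
            p.Runs (encodeInput Q V D Ha) (encodeNat (count Q D)) t := by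
  obtain ⟨p, P, h⟩ := PT.countAnswers
  -- the inner polynomial bounds the size of the input; its middle term is for the views
  refine ⟨p, P.comp (.X + (1 + .X * (6 * .X + 4)) + 3), fun Q V wq D L hV hD hL => ?_⟩
  obtain ⟨t, ht, hr⟩ := h (Q, V, D, L)
  refine ⟨t, ht.trans ?_, ?_⟩
  · simp only [Polynomial.eval_add, Polynomial.eval_mul, Polynomial.eval_X, Polynomial.eval_comp,
      Polynomial.eval_ofNat, Polynomial.eval_one]
    refine eval_mono P ?_
    have h1 : esize (Q, V, D, L) = Q.size + (esize V + (D.size + L.size + 1) + 1) + 1 := rfl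
    have h2 := esize_views_le hV.nodup_rel hD.declares_view
    have h3 : D.size ≤ Q.size + D.size + L.size := by omega
    have h4 : D.size * (6 * D.size + 4) ≤
        (Q.size + D.size + L.size) * (6 * (Q.size + D.size + L.size) + 4) := by gcongr
    omega
  · rw [← countAnswers_eq hV hD hL]
    exact hr
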